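/- Let $d\ge 1$. For $k=1,\dots,d$ let $-\infty\le a_k<b_k\le+\infty$, let $\mu_k$ be a probability measure on $(a_k,b_k)$ whose density is continuous and piecewise $C^1$ on $[a_k,b_k]$ (infinite end points excluded) and positive on $(a_k,b_k)$, and let $w_k$ be a function that is continuous on $[a_k,b_k]$ and piecewise $C^1$ and positive on $(a_k,b_k)$. Let $H^1(\mu_k,w_k)$ be the space of $f\in L^2(\mu_k)$ with a weak derivative $f'$ on $(a_k,b_k)$ such that $\int w_k (f')^2\,d\mu_k<\infty$. Assume that for each $k$ the pair $(\mu_k,w_k)$ has a Poincaré basis $(\psi_{k,j})_{j\in\mathbb N}$ with eigenvalues $0=\lambda_{k,0}<\lambda_{k,1}<\cdots$, that is, an orthonormal basis of $L^2(\mu_k)$ with $\psi_{k,j}\in H^1(\mu_k,w_k)$ and $$\int \psi_{k,j}'\,g'\,w_k\,d\mu_k=\lambda_{k,j}\int\psi_{k,j}\,g\,d\mu_k\qquad\text{for all } g\in H^1(\mu_k,w_k).$$ Let $X=(X_1,\dots,X_d)$ have law $\mu=\mu_1\otimes\cdots\otimes\mu_d$, let $\mathcal M\in L^2(\mu)$,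 and let $i\in\{1,\dots,d\}$ be such that $\partial\mathcal M/\partial x_i$ exists at every point of $\prod_k(a_k,b_k)$. For $\alpha\in\mathbb N^d$ put $\psi_\alpha(x)=\prod_k\psi_{k,\alpha_k}(x_k)$, and let $c_\alpha=\int\mathcal M\,\psi_\alpha\,d\mu$ be the coefficients of the Poincaré chaos expansion $\mathcal M=\sum_\alpha c_\alpha\psi_\alpha$. Then the weighted derivative-based sensitivity measure $\nu_i=\mathbb E\big[w_i(X_i)\,(\partial\mathcal M/\partial x_i(X))^2\big]\in[0,\infty]$ satisfies $$\nu_i=\sum_{\alpha\in\mathbb N^d,\ \alpha_i\ge1}\lambda_{i,\alpha_i}\,c_\alpha^2\qquad\text{(in }[0,\infty]\text{)}.$$ Moreover, $1/\lambda_{i,1}$ is the Poincaré constant $C_P(\mu_i,w_i)$, that is, the smallest $C$ with $\int f^2\,d\mu_i\le C\int w_i (f')^2\,d\mu_i$ for all $f\in H^1(\mu_i,w_i)$ with $\int f\,d\mu_i=0$. Finally, $\mathcal M(X)$ has a Sobol'–Hoeffding decomposition, that is, $\mathcal M(X)=\sum_{I\subseteq\{1,\dots,d\}}\mathcal M_I(X_I)$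 almost surely with square-integrable terms such that $\mathbb E[\mathcal M_I(X_I)\mid X_J]=0$ for all $J\subsetneq I$; and if $\operatorname{Var}(\mathcal M(X))>0$, then for this decomposition the total Sobol' index $S_i^{\mathrm{tot}}=\sum_{I\ni i}\operatorname{Var}(\mathcal M_I(X_I))/\operatorname{Var}(\mathcal M(X))$ satisfies $$S_i^{\mathrm{tot}}\le C_P(\mu_i,w_i)\,\frac{\nu_i}{\operatorname{Var}(\mathcal M(X))},\qquad C_P(\mu_i,w_i)=\frac1{\lambda_{i,1}}.$$ -/

import Mathlib

open MeasureTheory ProbabilityTheory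
open scoped ENNReal ContDiff

noncomputable section

/-- The open interval `(a, b)` of the real line, with possibly infinite end points. -/
def openInterval (a b : EReal) : Set ℝ := {x : ℝ | a < (x : EReal) ∧ (x : EReal) < b}

/-- The real points of `[a, b]`; an infinite end point is left out. -/
def closedInterval (a b : EReal) : Set ℝ := {x : ℝ | a ≤ (x : EReal) ∧ (x : EReal) ≤ b}

/-- `f` is piecewise `C¹` on the interval `J`: there is a set `F` of break points, finite in every
compact subinterval of `J`, such that `f` is `C¹`, up to the (one-sided) end points, on every
compact subinterval of `J` that has no break point in its interior. -/
def PiecewiseC1On (f : ℝ → ℝ) (J : Set ℝ) : Prop :=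
  ∃ F : Set ℝ,
    (∀ u v : ℝ, Set.Icc u v ⊆ J → (F ∩ Set.Icc u v).Finite) ∧
    ∀ u v : ℝ, u < v → Set.Icc u v ⊆ J → Disjoint (Set.Ioo u v) F →
      ContDiffOn ℝ 1 f (Set.Icc u v)

/-- The class `𝒫(a, b)` of probability measures on `(a, b)` with a density that is continuous and
piecewise `C¹` on `[a, b]` and positive on `(a, b)`. -/
def densityClass (a b : EReal) : Set (Measure ℝ) :=
  {μ | IsProbabilityMeasure μ ∧
    ∃ ρ : ℝ → ℝ, ContinuousOn ρ (closedInterval a b) ∧ PiecewiseC1On ρ (closedInterval a b) ∧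
      (∀ x ∈ openInterval a b, 0 < ρ x) ∧
      μ = (volume.restrict (openInterval a b)).withDensity fun x => ENNReal.ofReal (ρ x)}

/-- The class `𝒲(a, b)` of weights: continuous on `[a, b]`, piecewise `C¹` and positive on
`(a, b)`. -/
def weightClass (a b : EReal) : Set (ℝ → ℝ) :=
  {w | ContinuousOn w (closedInterval a b) ∧ PiecewiseC1On w (openInterval a b) ∧
    ∀ x ∈ openInterval a b, 0 < w x}

/-- `f'` is a weak derivative of `f` on `(a, b)`. -/
def IsWeakDeriv (a b : EReal) (f f' : ℝ → ℝ) : Prop :=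
  LocallyIntegrableOn f (openInterval a b) ∧ LocallyIntegrableOn f' (openInterval a b) ∧
    ∀ η : ℝ → ℝ, ContDiff ℝ ∞ η → HasCompactSupport η → tsupport η ⊆ openInterval a b →
      ∫ x in openInterval a b, f x * deriv η x = -∫ x in openInterval a b, f' x * η x

/-- `f` belongs to the weighted Sobolev space `H¹(μ, w)` on `(a, b)`, with weak derivative `f'`:
`f ∈ L²(μ)` and `f' ∈ L²(μ, w)`. -/
def MemH1 (a b : EReal) (μ : Measure ℝ) (w f f' : ℝ → ℝ) : Prop :=
  IsWeakDeriv a b f f' ∧ MemLp f 2 μ ∧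
    MemLp f' 2 (μ.withDensity fun x => ENNReal.ofReal (w x))

/-- `μ` satisfies the Poincaré inequality with weight `w` and constant `C`. -/
def PoincareInequality (a b : EReal) (μ : Measure ℝ) (w : ℝ → ℝ) (C : ℝ) : Prop :=
  ∀ f f' : ℝ → ℝ, MemH1 a b μ w f f' → ∫ x, f x ∂μ = 0 →
    ∫ x, f x ^ 2 ∂μ ≤ C * ∫ x, w x * f' x ^ 2 ∂μ

/-- `C` is the Poincaré constant `C_P(μ, w)`, the smallest constant in the inequality. -/
def IsPoincareConstant (a b : EReal) (μ : Measure ℝ) (w : ℝ → ℝ) (C : ℝ) : Prop :=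
  IsLeast {C : ℝ | PoincareInequality a b μ w C} C

/-- `f ∈ H¹(μ, w)` solves the spectral problem `⟨f', g'⟩_w = lam ⟨f, g⟩` for all `g ∈ H¹(μ, w)`. -/
def SolvesSpectralProblem (a b : EReal) (μ : Measure ℝ) (w : ℝ → ℝ) (lam : ℝ) (f : ℝ → ℝ) :
    Prop :=
  ∃ f' : ℝ → ℝ, MemH1 a b μ w f f' ∧
    ∀ g g' : ℝ → ℝ, MemH1 a b μ w g g' →
      ∫ x, f' x * g' x * w x ∂μ = lam * ∫ x, f x * g x ∂μ

/-- `φ` is the Poincaré basis of `(μ, w)`, with eigenvalues `0 = lam 0 < lam 1 < ⋯`: the `φ j` are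
eigenfunctions that form an orthonormal basis of `L²(μ)`. -/
structure IsPoincareBasis (a b : EReal) (μ : Measure ℝ) (w : ℝ → ℝ) (φ : ℕ → ℝ → ℝ)
    (lam : ℕ → ℝ) : Prop where
  lam_zero : lam 0 = 0
  lam_strictMono : StrictMono lam
  eigen : ∀ j, SolvesSpectralProblem a b μ w (lam j) (φ j)
  basis : ∃ e : HilbertBasis ℕ ℝ (Lp ℝ 2 μ), ∀ j, ⇑(e j) =ᵐ[μ] φ j

/-- The tensorized basis function `ψ_α(x) = ∏ₖ ψ_{k, αₖ}(xₖ)`. -/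
def tensorBasis {d : ℕ} (ψ : Fin d → ℕ → ℝ → ℝ) (α : Fin d → ℕ) (x : Fin d → ℝ) : ℝ :=
  ∏ k, ψ k (α k) (x k)

/-- The coefficient `c_α = ⟨M, ψ_α⟩` of the chaos expansion of `M`. -/
def chaosCoeff {d : ℕ} (μ : Fin d → Measure ℝ) (ψ : Fin d → ℕ → ℝ → ℝ) (M : (Fin d → ℝ) → ℝ)
    (α : Fin d → ℕ) : ℝ :=
  ∫ x, M x * tensorBasis ψ α x ∂Measure.pi μ

/-- The partial derivative `∂M/∂xᵢ`. -/
def partialDeriv {d : ℕ} (i : Fin d) (M : (Fin d → ℝ) → ℝ) (x : Fin d → ℝ) : ℝ :=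
  deriv (fun t => M (Function.update x i t)) (x i)

/-- The weighted derivative-based sensitivity measure `𝔼[wᵢ(Xᵢ) (∂M/∂xᵢ(X))²]`, an element of
`[0, ∞]`, where `X` has independent coordinates with laws `μ k`. -/
def dgsm {d : ℕ} (μ : Fin d → Measure ℝ) (wi : ℝ → ℝ) (i : Fin d) (M : (Fin d → ℝ) → ℝ) : ℝ≥0∞ :=
  ∫⁻ x, ENNReal.ofReal (wi (x i) * partialDeriv i M x ^ 2) ∂Measure.pi μ

/-- `N` is the Sobol'-Hoeffding decomposition of `M`: `M(X) = ∑_I N_I(X_I)`, where the terms are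
square integrable and `𝔼[N_I(X_I) | X_J] = 0` for all strict subsets `J` of `I`. -/
structure IsSobolHoeffding {d : ℕ} (P : Measure (Fin d → ℝ)) (M : (Fin d → ℝ) → ℝ)
    (N : (I : Finset (Fin d)) → (I → ℝ) → ℝ) : Prop where
  memLp : ∀ I, MemLp (fun x => N I (I.restrict x)) 2 P
  sum_eq : M =ᵐ[P] fun x => ∑ I, N I (I.restrict x)
  condExp_eq_zero : ∀ I J : Finset (Fin d), J ⊂ I →
    P[fun x => N I (I.restrict x) |
      MeasurableSpace.comap (fun x : Fin d → ℝ => J.restrict x) inferInstance] =ᵐ[P] 0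

/-- The total Sobol' index `Sᵢ^tot = ∑_{I ∋ i} Var N_I(X_I) / Var M(X)`, computed from the
Sobol'-Hoeffding decomposition `N` of `M`. -/
def totalSobolIndex {d : ℕ} (P : Measure (Fin d → ℝ)) (M : (Fin d → ℝ) → ℝ)
    (N : (I : Finset (Fin d)) → (I → ℝ) → ℝ) (i : Fin d) : ℝ :=
  (∑ I with i ∈ I, variance (fun x => N I (I.restrict x)) P) / variance M P

end

noncomputable section

open Set Filter Topology

/-! ### The fundamental lemma of the calculus of variations in dimension one -/

/-! In dimension one, testing the spectral problem of `φ j` against `φ k` shows that the derivatives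
`φ j'` are orthogonal in `L²(w μ)`, with squared norms `lam j`. Hence the energy `∫ w f'² dμ` should
equal `∑ lam j * c j ^ 2`, where `c j` are the coefficients of `f`. Bessel's inequality
(`sum_le_integral`) bounds the sum by the energy for every `f` in `H¹`. Conversely, if the sum is
finite, `∑ c j • φ j'` converges in `L²(w μ)`, and its limit is a weak derivative of `f` whose
energy is the sum (`exists_memH1`).

The difficulty is that `f` is only differentiable everywhere: its derivative need not be locally
integrable. If the sum converges, du Bois-Reymond's lemma identifies the weak derivative just built
with the classical one. If it diverges, the energy is infinite, since finite energy would put `f` in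
`H¹` and Bessel would apply.

In dimension `d`, this identity is applied on almost every line in direction `i`. Integrating over
the other variables and using Parseval for their tensor basis gives the formula for the sensitivity
measure (`dgsm_eq_tsum`); all sums live in `[0, ∞]`, so Tonelli suffices. The Poincaré constant
comes from Bessel and `lam 1 ≤ lam j`, with equality at `φ 1`.

For the Sobol' index, each `ψ k 0` is constant and the other `ψ k j` have mean zero, so conditioning
on `X_J` keeps exactly the coefficients with `multiSupport α ⊆ J`. Thus the term of index `I` in any
decomposition carries exactly the `α` with support `I`. The terms with `i ∈ I` collect the `α` with
`α i ≥ 1`, where `lam i 1 ≤ lam i (α i)`. -/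

lemma isOpen_openInterval (a b : EReal) : IsOpen (openInterval a b) :=
  (isOpen_lt continuous_const continuous_coe_real_ereal).inter
    (isOpen_lt continuous_coe_real_ereal continuous_const)

lemma deriv_eq_zero_of_notMem_tsupport {η : ℝ → ℝ} {x : ℝ} (hx : x ∉ tsupport η) :
    deriv η x = 0 := by
  by_contra h
  exact hx (support_deriv_subset h)

/-- A smooth function of integral zero, supported in `(p, q)`, is the derivative of a smooth
function supported in `(p, q)`. -/
lemma exists_contDiff_primitive {p q : ℝ} {ζ : ℝ → ℝ} (hζ : ContDiff ℝ ∞ ζ)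
    (hc : HasCompactSupport ζ) (hs : tsupport ζ ⊆ Ioo p q) (h0 : ∫ x in p..q, ζ x = 0) :
    ∃ Z : ℝ → ℝ, ContDiff ℝ ∞ Z ∧ tsupport Z ⊆ Ioo p q ∧ deriv Z = ζ := by
  rcases (tsupport ζ).eq_empty_or_nonempty with he | hne
  · rw [tsupport_eq_empty_iff] at he
    subst he
    exact ⟨0, contDiff_const, by simp [tsupport_eq_empty_iff.2 rfl], by ext; simp⟩
  have hr := hs (hc.isCompact.sInf_mem hne)
  have hs' := hs (hc.isCompact.sSup_mem hne)
  set r := sInf (tsupport ζ)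
  set s := sSup (tsupport ζ)
  have hsub : tsupport ζ ⊆ Icc r s := fun x hx =>
    ⟨csInf_le hc.isCompact.bddBelow hx, le_csSup hc.isCompact.bddAbove hx⟩
  have hz : ∀ x, x ∉ Icc r s → ζ x = 0 := fun x hx =>
    image_eq_zero_of_notMem_tsupport fun h => hx (hsub h)
  have hd : ∀ x, HasDerivAt (fun x => ∫ t in p..x, ζ t) (ζ x) x := fun x =>
    intervalIntegral.integral_hasDerivAt_right (hζ.continuous.intervalIntegrable _ _)
      (hζ.continuous.stronglyMeasurableAtFilter _ _) hζ.continuous.continuousAt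
  have hd' : deriv (fun x => ∫ t in p..x, ζ t) = ζ := funext fun x => (hd x).deriv
  refine ⟨fun x => ∫ t in p..x, ζ t, ?_, ?_, hd'⟩
  · rw [contDiff_infty_iff_deriv, hd']
    exact ⟨fun x => (hd x).differentiableAt, hζ⟩
  · refine (closure_minimal ?_ isClosed_Icc).trans (Icc_subset_Ioo hr.1 hs'.2)
    intro x hx
    by_contra hxI
    refine hx ?_
    rw [mem_Icc, not_and_or, not_le, not_le] at hxI
    rcases hxI with h | h
    · refine intervalIntegral.integral_zero_ae (ae_of_all _ fun t ht => hz t fun h' => ?_)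
      rcases (mem_uIoc.1 ht) with h2 | h2 <;> linarith [h'.1, hr.1]
    -- To the right of the support, the whole mass of `ζ` has been integrated, and it is zero.
    · beta_reduce
      rw [← intervalIntegral.integral_add_adjacent_intervals (b := q)
        (hζ.continuous.intervalIntegrable _ _) (hζ.continuous.intervalIntegrable _ _), h0, zero_add]
      refine intervalIntegral.integral_zero_ae (ae_of_all _ fun t ht => hz t fun h' => ?_)
      rcases (mem_uIoc.1 ht) with h2 | h2 <;> linarith [h'.2, hs'.2]

/-- The lemma of du Bois-Reymond, for continuous functions. -/
lemma exists_eqOn_const_of_integral_mul_deriv {p q : ℝ} (hpq : p < q) {h : ℝ → ℝ}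
    (hh : ContinuousOn h (Icc p q))
    (H : ∀ η : ℝ → ℝ, ContDiff ℝ ∞ η → tsupport η ⊆ Ioo p q →
      ∫ x in p..q, h x * deriv η x = 0) :
    ∃ c, EqOn h (fun _ => c) (Ioo p q) := by
  -- Any outer radius below `(q - p) / 2` keeps the support of the bump inside `(p, q)`.
  let φ : ContDiffBump ((p + q) / 2) := ⟨(q - p) / 8, (q - p) / 4, by linarith, by linarith⟩
  let η₀ : ℝ → ℝ := φ.normed volume
  have hη₀ : ContDiff ℝ ∞ η₀ := φ.contDiff_normed
  have hη₀s : tsupport η₀ ⊆ Ioo p q := by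
    rw [φ.tsupport_normed_eq, Real.closedBall_eq_Icc]
    exact Icc_subset_Ioo (by simp only [φ]; linarith) (by simp only [φ]; linarith)
  have conv : ∀ k η : ℝ → ℝ, tsupport η ⊆ Ioo p q →
      ∫ x in p..q, k x * η x = ∫ x, k x * η x := fun k η hη => by
    rw [intervalIntegral.integral_of_le hpq.le]
    refine setIntegral_eq_integral_of_forall_compl_eq_zero fun x hx => ?_
    rw [image_eq_zero_of_notMem_tsupport fun h' => hx (Ioo_subset_Ioc_self (hη h')), mul_zero]
  have hη₀i : ∫ x in p..q, η₀ x = 1 := by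
    have := conv 1 η₀ hη₀s
    simp only [Pi.one_apply, one_mul] at this
    rw [this, φ.integral_normed]
  have ii : ∀ η : ℝ → ℝ, Continuous η → IntervalIntegrable (fun x => h x * η x) volume p q :=
    fun η hη => ((uIcc_of_le hpq.le ▸ hh).mul hη.continuousOn).intervalIntegrable
  set c := ∫ x in p..q, h x * η₀ x with hc
  have key : ∀ᵐ x, x ∈ Ioo p q → h x - c = 0 := by
    refine isOpen_Ioo.ae_eq_zero_of_integral_contDiff_smul_eq_zero ?_ ?_
    · exact ((hh.mono Ioo_subset_Icc_self).sub continuousOn_const).locallyIntegrableOn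
        measurableSet_Ioo
    intro η hη hηc hηs
    have hI := hη.continuous.intervalIntegrable (μ := volume) p q
    have h0I := hη₀.continuous.intervalIntegrable (μ := volume) p q
    set m := ∫ x in p..q, η x with hm
    -- Subtracting `m * η₀` makes the integral zero, so the difference is the derivative of a test
    -- function `Z`, to which `H` applies.
    have hζs : tsupport (fun x => η x - m * η₀ x) ⊆ Ioo p q :=
      (tsupport_sub _ _).trans (union_subset hηs
        ((closure_mono (Function.support_mul_subset_right _ _)).trans hη₀s))
    obtain ⟨Z, hZ, hZs, hZd⟩ := exists_contDiff_primitive (p := p) (q := q)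
      (ζ := fun x => η x - m * η₀ x) (hη.sub (contDiff_const.mul hη₀))
      (HasCompactSupport.of_support_subset_isCompact isCompact_Icc
        ((subset_tsupport _).trans (hζs.trans Ioo_subset_Icc_self))) hζs (by
        rw [intervalIntegral.integral_sub hI (h0I.const_mul _),
          intervalIntegral.integral_const_mul, hη₀i, mul_one, sub_self])
    have h1 := H Z hZ hZs
    simp only [hZd, mul_sub] at h1
    rw [intervalIntegral.integral_sub (ii _ hη.continuous)
      (ii (fun x => m * η₀ x) (continuous_const.mul hη₀.continuous))] at h1
    have h2 : ∫ x in p..q, h x * (m * η₀ x) = m * c := by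
      rw [hc, ← intervalIntegral.integral_const_mul]
      congr 1; ext; ring
    simp only [smul_eq_mul]
    have h3 := conv (fun x => h x - c) η hηs
    simp only [mul_comm (η _)]
    rw [← h3]
    simp only [sub_mul]
    rw [intervalIntegral.integral_sub (ii _ hη.continuous) (hI.const_mul _),
      intervalIntegral.integral_const_mul]
    linarith
  refine ⟨c, ?_⟩
  refine Measure.eqOn_open_of_ae_eq (μ := volume) ?_ isOpen_Ioo (hh.mono Ioo_subset_Icc_self)
    continuousOn_const
  rw [Filter.EventuallyEq, ae_restrict_iff' measurableSet_Ioo]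
  filter_upwards [key] with x hx hx'
  linarith [hx hx']

/-- On a bounded interval, the classical derivative of a differentiable function is almost
everywhere equal to its weak derivative. -/
lemma ae_deriv_eq_of_forall_integral_eq {p q : ℝ} (hpq : p < q) {f g : ℝ → ℝ}
    (hf : ContinuousOn f (Icc p q)) (hg : IntegrableOn g (Icc p q))
    (H : ∀ η : ℝ → ℝ, ContDiff ℝ ∞ η → tsupport η ⊆ Ioo p q →
      ∫ x in p..q, f x * deriv η x = -∫ x in p..q, g x * η x) :
    ∀ᵐ x, x ∈ Ioo p q → deriv f x = g x := by
  have hgi : IntervalIntegrable g volume p q :=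
    (intervalIntegrable_iff_integrableOn_Icc_of_le hpq.le).2 hg
  set F : ℝ → ℝ := fun x => ∫ t in p..x, g t with hF
  have hac := hgi.absolutelyContinuousOnInterval_intervalIntegral (c := p) left_mem_uIcc
  have hFd : ∀ᵐ x, x ∈ uIcc p q → HasDerivAt F (g x) x := by
    filter_upwards [hgi.ae_hasDerivAt_integral] with x hx hx'
    exact hx hx' p left_mem_uIcc
  have hFc : ContinuousOn F (Icc p q) := by
    have := hac.continuousOn
    rwa [uIcc_of_le hpq.le] at this
  -- `f` and the primitive `F` have the same weak derivative `g`, so `f - F` is constant.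
  obtain ⟨c, hc⟩ := exists_eqOn_const_of_integral_mul_deriv hpq (hf.sub hFc) (fun η hη hηs => by
    have hηac : AbsolutelyContinuousOnInterval η p q :=
      (hη.of_le (by exact_mod_cast le_top)).contDiffOn.absolutelyContinuousOnInterval
    have hη' : Continuous (deriv η) := (contDiff_infty_iff_deriv.1 hη).2.continuous
    have hz : ∀ x, x ∉ Ioo p q → η x = 0 := fun x hx =>
      image_eq_zero_of_notMem_tsupport fun h => hx (hηs h)
    have h1 := hac.integral_mul_deriv_eq_deriv_mul hηac
    rw [hz q (by simp), hz p (by simp), mul_zero, mul_zero, sub_zero, zero_sub] at h1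
    have h2 : ∫ x in p..q, deriv F x * η x = ∫ x in p..q, g x * η x := by
      refine intervalIntegral.integral_congr_ae ?_
      filter_upwards [hFd] with x hx hx'
      rw [(hx (uIoc_subset_uIcc hx')).deriv]
    simp only [Pi.sub_apply, sub_mul]
    rw [intervalIntegral.integral_sub
      ((uIcc_of_le hpq.le ▸ hf).mul hη'.continuousOn).intervalIntegrable
      ((uIcc_of_le hpq.le ▸ hFc).mul hη'.continuousOn).intervalIntegrable, H η hη hηs]
    linarith)
  filter_upwards [hFd] with x hx hxI
  have hx' := hx (uIcc_of_le hpq.le ▸ Ioo_subset_Icc_self hxI)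
  have he : f =ᶠ[𝓝 x] fun y => F y + c := by
    filter_upwards [isOpen_Ioo.mem_nhds hxI] with y hy
    have := hc hy
    simp only [Pi.sub_apply] at this
    linarith
  rw [he.deriv_eq, (hx'.add_const c).deriv]

/-- Countably many intervals with rational end points cover `U`, and a countable union of null sets
is null. -/
lemma ae_mem_of_forall_Ioo {U : Set ℝ} (hU : IsOpen U) {P : ℝ → Prop}
    (h : ∀ p q : ℝ, p < q → Icc p q ⊆ U → ∀ᵐ x, x ∈ Ioo p q → P x) : ∀ᵐ x, x ∈ U → P x := by
  have h' : ∀ p q : ℚ, ∀ᵐ x : ℝ, Icc (p : ℝ) q ⊆ U → x ∈ Ioo (p : ℝ) q → P x := by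
    intro p q
    by_cases hs : Icc (p : ℝ) q ⊆ U
    · by_cases hpq : (p : ℝ) < q
      · filter_upwards [h p q hpq hs] with x hx _ using hx
      · exact ae_of_all _ fun x _ hx => absurd (hx.1.trans hx.2) hpq
    · exact ae_of_all _ fun x hx => absurd hx hs
  simp only [← ae_all_iff] at h'
  filter_upwards [h'] with x hx hxU
  obtain ⟨ε, hε, hb⟩ := Metric.isOpen_iff.1 hU x hxU
  obtain ⟨p, hp1, hp2⟩ := exists_rat_btwn (show x - ε < x by linarith)
  obtain ⟨q, hq1, hq2⟩ := exists_rat_btwn (show x < x + ε by linarith)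
  refine hx p q (fun y hy => hb ?_) ⟨hp2, hq1⟩
  rw [Real.ball_eq_Ioo]
  exact ⟨hp1.trans_le hy.1, hy.2.trans_lt hq2⟩

lemma IsWeakDeriv.ae_deriv_eq {a b : EReal} {f g : ℝ → ℝ} (h : IsWeakDeriv a b f g)
    (hf : ContinuousOn f (openInterval a b)) :
    ∀ᵐ x, x ∈ openInterval a b → deriv f x = g x := by
  refine ae_mem_of_forall_Ioo (isOpen_openInterval a b) fun p q hpq hsub => ?_
  refine ae_deriv_eq_of_forall_integral_eq hpq (hf.mono hsub)
    (h.2.1.integrableOn_compact_subset hsub isCompact_Icc) fun η hη hηs => ?_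
  have hc : HasCompactSupport η := HasCompactSupport.of_support_subset_isCompact isCompact_Icc
    ((subset_tsupport _).trans (hηs.trans Ioo_subset_Icc_self))
  have h1 := h.2.2 η hη hc (hηs.trans (Ioo_subset_Icc_self.trans hsub))
  have conv : ∀ k θ : ℝ → ℝ, (∀ x, x ∉ tsupport η → θ x = 0) →
      ∫ x in p..q, k x * θ x = ∫ x in openInterval a b, k x * θ x := fun k θ hθ => by
    rw [intervalIntegral.integral_of_le hpq.le]
    symm
    refine setIntegral_eq_of_subset_of_forall_sdiff_eq_zero
      (isOpen_openInterval a b).measurableSet (Ioc_subset_Icc_self.trans hsub) fun x hx => ?_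
    rw [hθ x fun h' => hx.2 (Ioo_subset_Ioc_self (hηs h')), mul_zero]
  rw [conv f _ fun x => deriv_eq_zero_of_notMem_tsupport,
    conv g _ fun x => image_eq_zero_of_notMem_tsupport, h1]

/-! ### Measures with a continuous positive density on an open set -/

/-- The measure on `U` with density `θ`. -/
def weightedVolume (U : Set ℝ) (θ : ℝ → ℝ) : Measure ℝ :=
  (volume.restrict U).withDensity fun x => ENNReal.ofReal (θ x)

section WeightedVolume

variable {U : Set ℝ} {θ : ℝ → ℝ}

lemma aemeasurable_ofReal_of_continuousOn (hU : IsOpen U) (hθ : ContinuousOn θ U) :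
    AEMeasurable (fun x => ENNReal.ofReal (θ x)) (volume.restrict U) :=
  (hθ.aemeasurable hU.measurableSet).ennreal_ofReal

lemma weightedVolume_absolutelyContinuous : weightedVolume U θ ≪ volume.restrict U :=
  withDensity_absolutelyContinuous _ _

lemma absolutelyContinuous_weightedVolume (hU : IsOpen U) (hθ : ContinuousOn θ U)
    (hpos : ∀ x ∈ U, 0 < θ x) : volume.restrict U ≪ weightedVolume U θ := by
  refine withDensity_absolutelyContinuous' (aemeasurable_ofReal_of_continuousOn hU hθ) ?_
  filter_upwards [ae_restrict_mem hU.measurableSet] with x hx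
  simpa using hpos x hx

lemma integral_weightedVolume (hU : IsOpen U) (hθ : ContinuousOn θ U) (hpos : ∀ x ∈ U, 0 < θ x)
    (F : ℝ → ℝ) : ∫ x, F x ∂weightedVolume U θ = ∫ x in U, θ x * F x := by
  rw [weightedVolume, integral_withDensity_eq_integral_toReal_smul₀
    (aemeasurable_ofReal_of_continuousOn hU hθ) (ae_of_all _ fun _ => ENNReal.ofReal_lt_top)]
  refine setIntegral_congr_fun hU.measurableSet fun x hx => ?_
  simp [ENNReal.toReal_ofReal (hpos x hx).le]

lemma integrable_weightedVolume_iff (hU : IsOpen U) (hθ : ContinuousOn θ U)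
    (hpos : ∀ x ∈ U, 0 < θ x) (F : ℝ → ℝ) :
    Integrable F (weightedVolume U θ) ↔ IntegrableOn (fun x => θ x * F x) U := by
  rw [weightedVolume, integrable_withDensity_iff_integrable_smul₀'
    (aemeasurable_ofReal_of_continuousOn hU hθ) (ae_of_all _ fun _ => ENNReal.ofReal_lt_top)]
  refine integrableOn_congr_fun (fun x hx => ?_) hU.measurableSet
  simp [ENNReal.toReal_ofReal (hpos x hx).le]

/-- On a compact set the density has a positive minimum `c`, and `|h| ≤ 1 + h² ≤ 1 + θ h² / c`. -/
lemma MeasureTheory.MemLp.locallyIntegrableOn_of_weightedVolume (hU : IsOpen U)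
    (hθ : ContinuousOn θ U) (hpos : ∀ x ∈ U, 0 < θ x) {h : ℝ → ℝ}
    (hh : MemLp h 2 (weightedVolume U θ)) : LocallyIntegrableOn h U := by
  rw [locallyIntegrableOn_iff hU.isLocallyClosed]
  intro K hKU hK
  have hsm : AEStronglyMeasurable h (volume.restrict U) :=
    hh.1.mono_ac (absolutelyContinuous_weightedVolume hU hθ hpos)
  have hsq := (integrable_weightedVolume_iff hU hθ hpos _).1 hh.integrable_sq
  rcases K.eq_empty_or_nonempty with rfl | hne
  · simp
  obtain ⟨x₀, hx₀, hmin⟩ := hK.exists_isMinOn hne (hθ.mono hKU)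
  have hc := hpos x₀ (hKU hx₀)
  have hK1 : IntegrableOn (fun _ : ℝ => (1 : ℝ)) K := by
    simp [hK.measure_lt_top]
  refine Integrable.mono' (hK1.add ((hsq.mono_set hKU).const_mul (1 / θ x₀)))
    (hsm.mono_set hKU) ?_
  filter_upwards [ae_restrict_mem hK.measurableSet] with x hx
  have h1 : θ x₀ ≤ θ x := hmin hx
  have h2 : h x ^ 2 ≤ 1 / θ x₀ * (θ x * h x ^ 2) := by
    rw [← mul_assoc, one_div, inv_mul_eq_div]
    exact le_mul_of_one_le_left (sq_nonneg _) ((one_le_div hc).2 h1)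
  simp only [Real.norm_eq_abs, Pi.add_apply]
  nlinarith [sq_nonneg (|h x| - 1), sq_abs (h x), abs_nonneg (h x)]

/-- Integration against a test function on `U` is represented by an element of `L²`. -/
lemma exists_memLp_forall_integral_mul_eq (hU : IsOpen U) (hθ : ContinuousOn θ U)
    (hpos : ∀ x ∈ U, 0 < θ x) {η : ℝ → ℝ} (hη : Continuous η) (hc : HasCompactSupport η)
    (hs : tsupport η ⊆ U) :
    ∃ k : ℝ → ℝ, MemLp k 2 (weightedVolume U θ) ∧
      ∀ h : ℝ → ℝ, ∫ x in U, h x * η x = ∫ x, h x * k x ∂weightedVolume U θ := by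
  have hcont : ∀ ζ : ℝ → ℝ, Continuous ζ → tsupport ζ ⊆ U → Continuous fun x => ζ x / θ x := by
    intro ζ hζ hζs
    refine continuous_of_tsupport fun x hx => ?_
    have hxU : x ∈ U := hζs (closure_mono (fun y hy => by
      simp only [Function.mem_support, ne_eq, div_eq_zero_iff, not_or] at hy
      exact hy.1) hx)
    exact hζ.continuousAt.div (hθ.continuousAt (hU.mem_nhds hxU)) (hpos x hxU).ne'
  -- Dividing by the density absorbs it; square integrability holds because `η² / θ` is continuous
  -- with compact support.
  refine ⟨fun x => η x / θ x, ?_, fun h => ?_⟩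
  · rw [memLp_two_iff_integrable_sq (hcont η hη hs).aestronglyMeasurable,
      integrable_weightedVolume_iff hU hθ hpos]
    have hsup : Function.support (fun x => η x * η x) ⊆ Function.support η :=
      Function.support_mul_subset_left _ _
    have h2 := hcont (fun x => η x * η x) (hη.mul hη) ((closure_mono hsup).trans hs)
    have hcs : HasCompactSupport fun x => η x * η x / θ x := by
      refine hc.mono fun x hx => hsup fun h0 => hx ?_
      simp only at h0 ⊢
      rw [h0, zero_div]
    refine (integrableOn_congr_fun (fun x hx => ?_) hU.measurableSet).2
      (h2.integrable_of_hasCompactSupport hcs).integrableOn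
    have := (hpos x hx).ne'
    field_simp
  · rw [integral_weightedVolume hU hθ hpos]
    refine setIntegral_congr_fun hU.measurableSet fun x hx => ?_
    have := (hpos x hx).ne'
    field_simp

end WeightedVolume

/-! ### Admissible measures and weights -/

section Admissible

variable {a b : EReal} {μ : Measure ℝ} {w : ℝ → ℝ}

lemma exists_eq_weightedVolume (hμ : μ ∈ densityClass a b) :
    ∃ ρ : ℝ → ℝ, ContinuousOn ρ (openInterval a b) ∧ (∀ x ∈ openInterval a b, 0 < ρ x) ∧
      μ = weightedVolume (openInterval a b) ρ := by
  obtain ⟨-, ρ, h1, -, h2, h3⟩ := hμ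
  exact ⟨ρ, h1.mono fun x hx => ⟨hx.1.le, hx.2.le⟩, h2, h3⟩

lemma continuousOn_of_mem_weightClass (hw : w ∈ weightClass a b) :
    ContinuousOn w (openInterval a b) :=
  hw.1.mono fun _ hx => ⟨hx.1.le, hx.2.le⟩

lemma ae_mem_openInterval (hμ : μ ∈ densityClass a b) : ∀ᵐ x ∂μ, x ∈ openInterval a b := by
  obtain ⟨ρ, -, -, rfl⟩ := exists_eq_weightedVolume hμ
  exact weightedVolume_absolutelyContinuous
    (ae_restrict_mem (isOpen_openInterval a b).measurableSet)

lemma absolutelyContinuous_of_mem_densityClass (hμ : μ ∈ densityClass a b) :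
    μ ≪ volume.restrict (openInterval a b) := by
  obtain ⟨ρ, -, -, rfl⟩ := exists_eq_weightedVolume hμ
  exact weightedVolume_absolutelyContinuous

lemma restrict_absolutelyContinuous_of_mem_densityClass (hμ : μ ∈ densityClass a b) :
    volume.restrict (openInterval a b) ≪ μ := by
  obtain ⟨ρ, h1, h2, rfl⟩ := exists_eq_weightedVolume hμ
  exact absolutelyContinuous_weightedVolume (isOpen_openInterval a b) h1 h2

lemma aemeasurable_weight (hμ : μ ∈ densityClass a b) (hw : w ∈ weightClass a b) :
    AEMeasurable w μ :=
  ((continuousOn_of_mem_weightClass hw).aemeasurable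
    (isOpen_openInterval a b).measurableSet).mono_ac (absolutelyContinuous_of_mem_densityClass hμ)

/-- The density `ρ * w` is again continuous and positive, so `L²(w μ)` is covered by the same lemmas
as `L²(μ)`. -/
lemma exists_withDensity_eq_weightedVolume (hμ : μ ∈ densityClass a b)
    (hw : w ∈ weightClass a b) :
    ∃ θ : ℝ → ℝ, ContinuousOn θ (openInterval a b) ∧ (∀ x ∈ openInterval a b, 0 < θ x) ∧
      μ.withDensity (fun x => ENNReal.ofReal (w x)) = weightedVolume (openInterval a b) θ := by
  obtain ⟨ρ, h1, h2, rfl⟩ := exists_eq_weightedVolume hμ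
  have hU := isOpen_openInterval a b
  have hwc := continuousOn_of_mem_weightClass hw
  refine ⟨fun x => ρ x * w x, h1.mul hwc, fun x hx => mul_pos (h2 x hx) (hw.2.2 x hx), ?_⟩
  rw [weightedVolume, weightedVolume, ← withDensity_mul₀ (aemeasurable_ofReal_of_continuousOn hU h1)
    (aemeasurable_ofReal_of_continuousOn hU hwc)]
  refine withDensity_congr_ae ?_
  filter_upwards [ae_restrict_mem hU.measurableSet] with x hx
  rw [Pi.mul_apply, ENNReal.ofReal_mul (h2 x hx).le]

lemma integral_withDensity_weight (hμ : μ ∈ densityClass a b) (hw : w ∈ weightClass a b)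
    (F : ℝ → ℝ) :
    ∫ x, F x ∂μ.withDensity (fun x => ENNReal.ofReal (w x)) = ∫ x, w x * F x ∂μ := by
  rw [integral_withDensity_eq_integral_toReal_smul₀ (aemeasurable_weight hμ hw).ennreal_ofReal
    (ae_of_all _ fun _ => ENNReal.ofReal_lt_top)]
  refine integral_congr_ae ?_
  filter_upwards [ae_mem_openInterval hμ] with x hx
  simp [ENNReal.toReal_ofReal (hw.2.2 x hx).le]

lemma integrable_withDensity_weight_iff (hμ : μ ∈ densityClass a b) (hw : w ∈ weightClass a b)
    (F : ℝ → ℝ) :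
    Integrable F (μ.withDensity (fun x => ENNReal.ofReal (w x))) ↔
      Integrable (fun x => w x * F x) μ := by
  rw [integrable_withDensity_iff_integrable_smul₀' (aemeasurable_weight hμ hw).ennreal_ofReal
    (ae_of_all _ fun _ => ENNReal.ofReal_lt_top)]
  refine integrable_congr ?_
  filter_upwards [ae_mem_openInterval hμ] with x hx
  simp [ENNReal.toReal_ofReal (hw.2.2 x hx).le]

lemma integral_mul_mul_weight (hμ : μ ∈ densityClass a b) (hw : w ∈ weightClass a b)
    (f g : ℝ → ℝ) :
    ∫ x, f x * g x * w x ∂μ =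
      ∫ x, f x * g x ∂μ.withDensity (fun x => ENNReal.ofReal (w x)) := by
  rw [integral_withDensity_weight hμ hw]
  congr 1; ext; ring

end Admissible

lemma inner_toLp_toLp {α : Type*} [MeasurableSpace α] {m : Measure α} {f g : α → ℝ}
    (hf : MemLp f 2 m) (hg : MemLp g 2 m) :
    inner ℝ (hf.toLp f) (hg.toLp g) = ∫ x, f x * g x ∂m := by
  rw [L2.inner_def]
  refine integral_congr_ae ?_
  filter_upwards [hf.coeFn_toLp, hg.coeFn_toLp] with x h1 h2
  rw [h1, h2]
  simp [mul_comm]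

lemma inner_Lp_toLp {α : Type*} [MeasurableSpace α] {m : Measure α} (F : Lp ℝ 2 m) {g : α → ℝ}
    (hg : MemLp g 2 m) : inner ℝ F (hg.toLp g) = ∫ x, F x * g x ∂m := by
  rw [← inner_toLp_toLp (Lp.memLp F) hg, Lp.toLp_coeFn]

/-! ### Poincaré bases in dimension one -/

namespace IsPoincareBasis

variable {a b : EReal} {μ : Measure ℝ} {w : ℝ → ℝ} {φ : ℕ → ℝ → ℝ} {lam : ℕ → ℝ}

lemma memLp (h : IsPoincareBasis a b μ w φ lam) (j : ℕ) : MemLp (φ j) 2 μ := by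
  obtain ⟨_, h', -⟩ := h.eigen j
  exact h'.2.1

lemma lam_nonneg (h : IsPoincareBasis a b μ w φ lam) (j : ℕ) : 0 ≤ lam j :=
  h.lam_zero ▸ h.lam_strictMono.monotone (Nat.zero_le j)

lemma exists_basis (h : IsPoincareBasis a b μ w φ lam) :
    ∃ e : HilbertBasis ℕ ℝ (Lp ℝ 2 μ), ∀ j, e j = (h.memLp j).toLp (φ j) := by
  obtain ⟨e, he⟩ := h.basis
  exact ⟨e, fun j => Lp.ext ((he j).trans (h.memLp j).coeFn_toLp.symm)⟩

lemma integral_mul_eq (h : IsPoincareBasis a b μ w φ lam) (j k : ℕ) :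
    ∫ x, φ j x * φ k x ∂μ = if j = k then 1 else 0 := by
  obtain ⟨e, he⟩ := h.exists_basis
  rw [← inner_toLp_toLp (h.memLp j) (h.memLp k), ← he, ← he]
  exact orthonormal_iff_ite.1 e.orthonormal j k

lemma hasSum_integral_mul (h : IsPoincareBasis a b μ w φ lam) {f k : ℝ → ℝ} (hf : MemLp f 2 μ)
    (hk : MemLp k 2 μ) :
    HasSum (fun j => (∫ x, f x * φ j x ∂μ) * ∫ x, φ j x * k x ∂μ) (∫ x, f x * k x ∂μ) := by
  obtain ⟨e, he⟩ := h.exists_basis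
  have := e.hasSum_inner_mul_inner (hf.toLp f) (hk.toLp k)
  simpa only [he, inner_toLp_toLp] using this

lemma hasSum_sq (h : IsPoincareBasis a b μ w φ lam) {f : ℝ → ℝ} (hf : MemLp f 2 μ) :
    HasSum (fun j => (∫ x, f x * φ j x ∂μ) ^ 2) (∫ x, f x ^ 2 ∂μ) := by
  have := h.hasSum_integral_mul hf hf
  simpa only [mul_comm (φ _ _), ← sq] using this

/-- Bessel's inequality for the derivatives of the basis functions. -/
lemma sum_le_integral (h : IsPoincareBasis a b μ w φ lam) (hμ : μ ∈ densityClass a b)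
    (hw : w ∈ weightClass a b) {f f' : ℝ → ℝ} (hf : MemH1 a b μ w f f') (s : Finset ℕ) :
    ∑ j ∈ s, lam j * (∫ x, f x * φ j x ∂μ) ^ 2 ≤ ∫ x, w x * f' x ^ 2 ∂μ := by
  choose u hu hu' using h.eigen
  let U := fun j => (hu j).2.2.toLp (u j)
  have hUU : ∀ j k, inner ℝ (U j) (U k) = if j = k then lam j else 0 := fun j k => by
    rw [inner_toLp_toLp, ← integral_mul_mul_weight hμ hw, hu' j _ _ (hu k), h.integral_mul_eq]
    simp
  have hUf : ∀ j, inner ℝ (U j) (hf.2.2.toLp f') = lam j * ∫ x, f x * φ j x ∂μ := fun j => by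
    rw [inner_toLp_toLp, ← integral_mul_mul_weight hμ hw, hu' j _ _ hf]
    simp only [mul_comm]
  set c := fun j => ∫ x, f x * φ j x ∂μ
  -- The squared norm of this residual is the energy of `f'` minus the partial sum.
  have h0 := real_inner_self_nonneg (x := hf.2.2.toLp f' - ∑ j ∈ s, c j • U j)
  have h1 : inner ℝ (∑ j ∈ s, c j • U j) (hf.2.2.toLp f') = ∑ j ∈ s, lam j * c j ^ 2 := by
    rw [sum_inner]
    refine Finset.sum_congr rfl fun j _ => ?_
    rw [inner_smul_left, hUf]
    simp only [conj_trivial]; ring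
  have h2 : inner ℝ (∑ j ∈ s, c j • U j) (∑ j ∈ s, c j • U j) = ∑ j ∈ s, lam j * c j ^ 2 := by
    rw [sum_inner]
    refine Finset.sum_congr rfl fun j hj => ?_
    rw [inner_sum, Finset.sum_eq_single_of_mem j hj fun k _ hk => by
      rw [inner_smul_left, inner_smul_right, hUU, if_neg hk.symm]; simp]
    rw [inner_smul_left, inner_smul_right, hUU, if_pos rfl]
    simp only [conj_trivial]; ring
  rw [real_inner_sub_sub_self, real_inner_comm (∑ j ∈ s, c j • U j), h1, h2, inner_toLp_toLp,
    integral_withDensity_weight hμ hw] at h0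
  simp only [sq] at h0 ⊢
  linarith

/-- A function whose coefficients satisfy `∑ λⱼ cⱼ² < ∞` belongs to `H¹`. -/
lemma exists_memH1 (h : IsPoincareBasis a b μ w φ lam) (hμ : μ ∈ densityClass a b)
    (hw : w ∈ weightClass a b) {f : ℝ → ℝ} (hf : MemLp f 2 μ)
    (hs : Summable fun j => lam j * (∫ x, f x * φ j x ∂μ) ^ 2) :
    ∃ g, MemH1 a b μ w f g ∧
      ∫ x, w x * g x ^ 2 ∂μ = ∑' j, lam j * (∫ x, f x * φ j x ∂μ) ^ 2 := by
  choose u hu hu' using h.eigen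
  let U := fun j => (hu j).2.2.toLp (u j)
  have hUU : ∀ j k, inner ℝ (U j) (U k) = if j = k then lam j else 0 := fun j k => by
    rw [inner_toLp_toLp, ← integral_mul_mul_weight hμ hw, hu' j _ _ (hu k), h.integral_mul_eq]
    simp
  set c := fun j => ∫ x, f x * φ j x ∂μ with hc
  have h2 : ∀ s : Finset ℕ, ‖∑ j ∈ s, c j • U j‖ ^ 2 = ∑ j ∈ s, lam j * c j ^ 2 := fun s => by
    rw [← real_inner_self_eq_norm_sq, sum_inner]
    refine Finset.sum_congr rfl fun j hj => ?_
    rw [inner_sum, Finset.sum_eq_single_of_mem j hj fun k _ hk => by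
      rw [inner_smul_left, inner_smul_right, hUU, if_neg hk.symm]; simp]
    rw [inner_smul_left, inner_smul_right, hUU, if_pos rfl]
    simp only [conj_trivial]; ring
  have hsum : Summable fun j => c j • U j := by
    rw [summable_iff_vanishing_norm]
    intro ε hε
    -- By `h2` the finite sums of the real series are squared norms, hence the threshold `ε ^ 2`.
    obtain ⟨s, hs'⟩ := summable_iff_vanishing_norm.1 hs (ε ^ 2) (by positivity)
    refine ⟨s, fun t ht => ?_⟩
    have := (le_abs_self _).trans_lt (hs' t ht)
    rw [← h2] at this
    exact lt_of_pow_lt_pow_left₀ 2 hε.le this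
  obtain ⟨G, hG⟩ := hsum
  obtain ⟨ρ, hρ1, hρ2, hρ3⟩ := exists_eq_weightedVolume hμ
  obtain ⟨θ, hθ1, hθ2, hθ3⟩ := exists_withDensity_eq_weightedVolume hμ hw
  have hI := isOpen_openInterval a b
  refine ⟨G, ⟨⟨?_, ?_, ?_⟩, hf, Lp.memLp G⟩, ?_⟩
  · exact MemLp.locallyIntegrableOn_of_weightedVolume hI hρ1 hρ2 (hρ3 ▸ hf)
  · exact MemLp.locallyIntegrableOn_of_weightedVolume hI hθ1 hθ2 (hθ3 ▸ Lp.memLp G)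
  · intro η hη hηc hηs
    have hη' : Continuous (deriv η) := (contDiff_infty_iff_deriv.1 hη).2.continuous
    -- `k` represents `deriv η` in `L²(μ)` and `l` represents `η` in `L²(w μ)`. Both sides of the
    -- weak derivative identity become inner products, so the identity for each `φ j` sums to the
    -- one for `f`.
    obtain ⟨k, hk, hk'⟩ := exists_memLp_forall_integral_mul_eq hI hρ1 hρ2 hη'
      hηc.deriv ((closure_minimal support_deriv_subset (isClosed_tsupport _)).trans hηs)
    obtain ⟨l, hl, hl'⟩ := exists_memLp_forall_integral_mul_eq hI hθ1 hθ2 hη.continuous hηc hηs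
    rw [← hρ3] at hk hk'
    rw [← hθ3] at hl hl'
    have e1 := h.hasSum_integral_mul hf hk
    have e2 : HasSum (fun j => c j * inner ℝ (U j) (hl.toLp l)) (inner ℝ G (hl.toLp l)) := by
      have := hG.mapL (innerSL ℝ (hl.toLp l))
      simpa only [innerSL_apply_apply, inner_smul_right, real_inner_comm (hl.toLp l)] using this
    have e3 : ∀ j, ∫ x, φ j x * k x ∂μ = -inner ℝ (U j) (hl.toLp l) := fun j => by
      rw [inner_toLp_toLp, ← hk', ← hl']
      exact (hu j).1.2.2 η hη hηc hηs
    rw [hk', hl', ← inner_Lp_toLp G hl]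
    refine e1.unique ?_
    simp only [e3, mul_neg]
    exact e2.neg
  · have h3 : Tendsto (fun s : Finset ℕ => ‖∑ j ∈ s, c j • U j‖ ^ 2) atTop (𝓝 (‖G‖ ^ 2)) :=
      (Tendsto.norm hG).pow 2
    simp only [h2] at h3
    rw [HasSum.tsum_eq (show HasSum _ _ from h3), ← real_inner_self_eq_norm_sq, L2.inner_def,
      ← integral_withDensity_weight hμ hw]
    simp [sq]

end IsPoincareBasis

/-! ### Weak derivatives of everywhere differentiable functions -/

lemma integrable_mul_of_locallyIntegrableOn {U : Set ℝ} {g ζ : ℝ → ℝ}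
    (hg : LocallyIntegrableOn g U) (hζ : Continuous ζ) (hc : HasCompactSupport ζ)
    (hs : tsupport ζ ⊆ U) : Integrable fun x => g x * ζ x := by
  rw [← integrableOn_iff_integrable_of_support_subset (s := tsupport ζ)
    ((Function.support_mul_subset_right _ _).trans (subset_tsupport _))]
  exact (hg.integrableOn_compact_subset hs hc.isCompact).mul_continuousOn hζ.continuousOn
    hc.isCompact

section

variable {a b : EReal} {μ : Measure ℝ} {w : ℝ → ℝ} {f : ℝ → ℝ}

/-- An everywhere differentiable function with locally integrable derivative is weakly
differentiable. -/
lemma isWeakDeriv_deriv (hf : ∀ x ∈ openInterval a b, DifferentiableAt ℝ f x)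
    (hf' : LocallyIntegrableOn (deriv f) (openInterval a b)) :
    IsWeakDeriv a b f (deriv f) := by
  have hfl : LocallyIntegrableOn f (openInterval a b) :=
    ContinuousOn.locallyIntegrableOn (fun x hx => (hf x hx).continuousAt.continuousWithinAt)
      (isOpen_openInterval a b).measurableSet
  refine ⟨hfl, hf', fun η hη hc hs => ?_⟩
  have hη' : Continuous (deriv η) := (contDiff_infty_iff_deriv.1 hη).2.continuous
  have hs' : tsupport (deriv η) ⊆ tsupport η :=
    closure_minimal support_deriv_subset (isClosed_tsupport _)
  have i1 := integrable_mul_of_locallyIntegrableOn hf' hη.continuous hc hs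
  have i2 := integrable_mul_of_locallyIntegrableOn hfl hη' hc.deriv (hs'.trans hs)
  have i3 := integrable_mul_of_locallyIntegrableOn hfl hη.continuous hc hs
  have hd : ∀ x, HasDerivAt (fun x => f x * η x) (deriv f x * η x + f x * deriv η x) x := by
    intro x
    by_cases hx : x ∈ tsupport η
    · exact (hf x (hs hx)).hasDerivAt.mul (hη.differentiable (by simp) x).hasDerivAt
    · have h0 : η =ᶠ[𝓝 x] 0 := notMem_tsupport_iff_eventuallyEq.1 hx
      rw [deriv_eq_zero_of_notMem_tsupport hx, image_eq_zero_of_notMem_tsupport hx, mul_zero,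
        mul_zero, add_zero]
      refine (hasDerivAt_const x (0 : ℝ)).congr_of_eventuallyEq ?_
      filter_upwards [h0] with y hy
      simp [hy]
  -- This form of the fundamental theorem needs differentiability everywhere and an integrable
  -- derivative, but no continuity of `deriv f`.
  have h := integral_eq_zero_of_hasDerivAt_of_integrable hd (i1.add i2) i3
  rw [integral_add i1 i2] at h
  rw [setIntegral_eq_integral_of_forall_compl_eq_zero fun x hx => by
      rw [deriv_eq_zero_of_notMem_tsupport fun h => hx (hs h), mul_zero],
    setIntegral_eq_integral_of_forall_compl_eq_zero fun x hx => by
      rw [image_eq_zero_of_notMem_tsupport fun h => hx (hs h), mul_zero]]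
  linarith

/-- Finite energy makes `deriv f` locally integrable, which is all that `isWeakDeriv_deriv` lacks.
-/
lemma memH1_deriv (hμ : μ ∈ densityClass a b) (hw : w ∈ weightClass a b)
    (hf : ∀ x ∈ openInterval a b, DifferentiableAt ℝ f x) (hf2 : MemLp f 2 μ)
    (hfin : ∫⁻ x, ENNReal.ofReal (w x * deriv f x ^ 2) ∂μ ≠ ⊤) : MemH1 a b μ w f (deriv f) := by
  have hm : MemLp (deriv f) 2 (μ.withDensity fun x => ENNReal.ofReal (w x)) := by
    rw [memLp_two_iff_integrable_sq (measurable_deriv f).aestronglyMeasurable,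
      integrable_withDensity_weight_iff hμ hw]
    refine ⟨((aemeasurable_weight hμ hw).mul
      ((measurable_deriv f).pow_const 2).aemeasurable).aestronglyMeasurable, ?_⟩
    rw [hasFiniteIntegral_iff_ofReal]
    · exact hfin.lt_top
    · filter_upwards [ae_mem_openInterval hμ] with x hx
      exact mul_nonneg (hw.2.2 x hx).le (sq_nonneg _)
  obtain ⟨θ, hθ1, hθ2, hθ3⟩ := exists_withDensity_eq_weightedVolume hμ hw
  exact ⟨isWeakDeriv_deriv hf (MemLp.locallyIntegrableOn_of_weightedVolume
    (isOpen_openInterval a b) hθ1 hθ2 (hθ3 ▸ hm)), hf2, hm⟩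

lemma memH1_const (hμ : μ ∈ densityClass a b) (hw : w ∈ weightClass a b) :
    MemH1 a b μ w (fun _ => 1) (fun _ => 0) := by
  have : IsProbabilityMeasure μ := hμ.1
  have := memH1_deriv (f := fun _ => 1) hμ hw (fun x _ => differentiableAt_const _)
    (memLp_const _) (by simp)
  simpa using this

end

/-! ### Parseval's identity for the energy, and the spectral gap -/

namespace IsPoincareBasis

variable {a b : EReal} {μ : Measure ℝ} {w : ℝ → ℝ} {φ : ℕ → ℝ → ℝ} {lam : ℕ → ℝ}

/-- Parseval's identity for the weighted energy of an everywhere differentiable function. -/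
theorem lintegral_weight_mul_deriv_sq (h : IsPoincareBasis a b μ w φ lam)
    (hμ : μ ∈ densityClass a b) (hw : w ∈ weightClass a b) {f : ℝ → ℝ}
    (hf : ∀ x ∈ openInterval a b, DifferentiableAt ℝ f x) (hf2 : MemLp f 2 μ) :
    ∫⁻ x, ENNReal.ofReal (w x * deriv f x ^ 2) ∂μ =
      ∑' j, ENNReal.ofReal (lam j * (∫ x, f x * φ j x ∂μ) ^ 2) := by
  have hnn : ∀ j, 0 ≤ lam j * (∫ x, f x * φ j x ∂μ) ^ 2 := fun j =>
    mul_nonneg (h.lam_nonneg j) (sq_nonneg _)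
  by_cases hs : Summable fun j => lam j * (∫ x, f x * φ j x ∂μ) ^ 2
  · obtain ⟨g, hg, hg'⟩ := h.exists_memH1 hμ hw hf2 hs
    have hae : ∀ᵐ x ∂μ, deriv f x = g x := by
      have h1 := hg.1.ae_deriv_eq fun x hx => (hf x hx).continuousAt.continuousWithinAt
      exact absolutelyContinuous_of_mem_densityClass hμ
        ((ae_restrict_iff' (isOpen_openInterval a b).measurableSet).2 h1)
    rw [← ENNReal.ofReal_tsum_of_nonneg hnn hs, ← hg', ofReal_integral_eq_lintegral_ofReal
      ((integrable_withDensity_weight_iff hμ hw _).1 hg.2.2.integrable_sq)]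
    · refine lintegral_congr_ae ?_
      filter_upwards [hae] with x hx
      rw [hx]
    · filter_upwards [ae_mem_openInterval hμ] with x hx
      exact mul_nonneg (hw.2.2 x hx).le (sq_nonneg _)
  -- When the series diverges, both sides are infinite: finite energy would bound its partial sums
  -- by Bessel.
  · trans ⊤
    · by_contra hfin
      exact hs (summable_of_sum_le hnn (h.sum_le_integral hμ hw (memH1_deriv hμ hw hf hf2 hfin)))
    · by_contra hfin
      refine hs ?_
      have := ENNReal.summable_toReal (Ne.symm hfin)
      simpa only [ENNReal.toReal_ofReal (hnn _)] using this

/-- The constant `1`, with derivative `0`, is an admissible test function in the spectral problem,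
and `lam j ≠ 0`. -/
lemma integral_eq_zero (h : IsPoincareBasis a b μ w φ lam) (hμ : μ ∈ densityClass a b)
    (hw : w ∈ weightClass a b) {j : ℕ} (hj : j ≠ 0) : ∫ x, φ j x ∂μ = 0 := by
  obtain ⟨u, -, hu⟩ := h.eigen j
  have h1 := hu _ _ (memH1_const hμ hw)
  simp only [mul_zero, zero_mul, integral_zero, mul_one] at h1
  have : 0 < lam j := h.lam_zero ▸ h.lam_strictMono (Nat.pos_of_ne_zero hj)
  exact (mul_eq_zero.1 h1.symm).resolve_left this.ne'

/-- The eigenfunction for the eigenvalue zero is constant. -/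
lemma exists_ae_eq_const (h : IsPoincareBasis a b μ w φ lam) (hμ : μ ∈ densityClass a b)
    (hw : w ∈ weightClass a b) : ∃ c : ℝ, c ^ 2 = 1 ∧ φ 0 =ᵐ[μ] fun _ => c := by
  have : IsProbabilityMeasure μ := hμ.1
  have h1 := h.hasSum_sq (f := fun _ => 1) (memLp_const _)
  -- Parseval for the constant `1` has a single nonzero term, so the mean of `φ 0` squares to `1`;
  -- as its norm is also `1`, its variance vanishes.
  have h2 := h1.unique (hasSum_single 0 fun j hj => by simp [h.integral_eq_zero hμ hw hj])
  simp only [one_mul, one_pow, integral_const, probReal_univ, smul_eq_mul, mul_one] at h2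
  refine ⟨∫ x, φ 0 x ∂μ, h2.symm, ?_⟩
  set c := ∫ x, φ 0 x ∂μ with hc
  have hsub : MemLp (fun x => φ 0 x - c) 2 μ := (h.memLp 0).sub (memLp_const c)
  have hint : Integrable (φ 0) μ := (h.memLp 0).integrable one_le_two
  have h3 : ∫ x, (φ 0 x - c) ^ 2 ∂μ = 0 := by
    have e : ∀ x, (φ 0 x - c) ^ 2 = φ 0 x * φ 0 x - 2 * c * φ 0 x + c ^ 2 := fun x => by ring
    simp only [e]
    have hsq : Integrable (fun x => φ 0 x * φ 0 x) μ := by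
      simpa only [sq] using (h.memLp 0).integrable_sq
    have hi : Integrable (fun x => φ 0 x * φ 0 x - 2 * c * φ 0 x) μ := hsq.sub (hint.const_mul _)
    rw [integral_add hi (integrable_const _), integral_sub hsq (hint.const_mul _),
      h.integral_mul_eq, integral_const_mul, ← hc]
    simp only [if_true, integral_const, probReal_univ, smul_eq_mul, one_mul]
    linarith
  rw [integral_eq_zero_iff_of_nonneg (fun x => sq_nonneg _) hsub.integrable_sq] at h3
  filter_upwards [h3] with x hx
  simp only [Pi.zero_apply] at hx
  have := pow_eq_zero_iff (two_ne_zero) |>.1 hx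
  linarith

/-- The Poincaré constant is the inverse of the spectral gap. -/
theorem isPoincareConstant (h : IsPoincareBasis a b μ w φ lam) (hμ : μ ∈ densityClass a b)
    (hw : w ∈ weightClass a b) : IsPoincareConstant a b μ w (1 / lam 1) := by
  have : IsProbabilityMeasure μ := hμ.1
  have hpos : 0 < lam 1 := h.lam_zero ▸ h.lam_strictMono Nat.one_pos
  constructor
  · intro f f' hf h0
    obtain ⟨c, -, hc⟩ := h.exists_ae_eq_const hμ hw
    have hc0 : ∫ x, f x * φ 0 x ∂μ = 0 := by
      rw [integral_congr_ae (g := fun x => f x * c)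
        (by filter_upwards [hc] with x hx; rw [hx]), integral_mul_const, h0, zero_mul]
    rw [one_div, inv_mul_eq_div, le_div_iff₀ hpos, mul_comm]
    refine hasSum_le_of_sum_le ((h.hasSum_sq hf.2.1).mul_left (lam 1)) fun s => ?_
    refine (Finset.sum_le_sum fun j _ => ?_).trans (h.sum_le_integral hμ hw hf s)
    rcases Nat.eq_zero_or_pos j with rfl | hj
    · simp [hc0]
    · exact mul_le_mul_of_nonneg_right (h.lam_strictMono.monotone hj) (sq_nonneg _)
  -- For `φ 1` the inequality reads `1 ≤ C * lam 1`.
  · intro C hC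
    obtain ⟨u, hu, hu'⟩ := h.eigen 1
    have h1 := hC _ _ hu (h.integral_eq_zero hμ hw one_ne_zero)
    have h2 := hu' _ _ hu
    have h3 := h.integral_mul_eq 1 1
    rw [h3] at h2
    have e : ∫ x, w x * u x ^ 2 ∂μ = lam 1 := by
      simp only [if_true, mul_one] at h2
      rw [← h2]
      congr 1; ext; ring
    simp only [sq (φ 1 _)] at h1
    rw [h3, e] at h1
    rw [div_le_iff₀ hpos]
    simpa using h1

end IsPoincareBasis

/-! ### Slices of square integrable functions on a product -/

lemma MeasureTheory.MemLp.integrable_mul_two {X : Type*} [MeasurableSpace X] {m : Measure X}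
    {f g : X → ℝ} (hf : MemLp f 2 m) (hg : MemLp g 2 m) : Integrable (fun x => f x * g x) m :=
  hf.integrable_mul hg

lemma sq_integral_mul_le {X : Type*} [MeasurableSpace X] {m : Measure X} {f g : X → ℝ}
    (hf : MemLp f 2 m) (hg : MemLp g 2 m) :
    (∫ x, f x * g x ∂m) ^ 2 ≤ (∫ x, f x ^ 2 ∂m) * ∫ x, g x ^ 2 ∂m := by
  have := real_inner_mul_inner_self_le (hf.toLp f) (hg.toLp g)
  simpa only [inner_toLp_toLp, ← sq] using this

section Slices

variable {X Y : Type*} [MeasurableSpace X] [MeasurableSpace Y] {m : Measure X} {n : Measure Y}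
  {f : X × Y → ℝ} {φ : Y → ℝ} {χ : X → ℝ}

lemma memLp_mul_prod (hχ : MemLp χ 2 m) (hφ : MemLp φ 2 n) :
    MemLp (fun p : X × Y => χ p.1 * φ p.2) 2 (m.prod n) := by
  refine (memLp_two_iff_integrable_sq (f := fun p : X × Y => χ p.1 * φ p.2)
    (hχ.1.comp_fst.mul hφ.1.comp_snd)).2 ?_
  simpa only [mul_pow] using hχ.integrable_sq.mul_prod hφ.integrable_sq

variable [SFinite m] [SFinite n]

lemma ae_memLp_slice (hf : MemLp f 2 (m.prod n)) : ∀ᵐ x ∂m, MemLp (fun y => f (x, y)) 2 n := by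
  filter_upwards [hf.1.prodMk_left, hf.integrable_sq.prod_right_ae] with x h1 h2
  exact (memLp_two_iff_integrable_sq h1).2 h2

/-- Cauchy-Schwarz on each slice bounds the square by `‖f (x, ·)‖² ‖φ‖²`, which is integrable in
`x`. -/
lemma memLp_integral_slice (hf : MemLp f 2 (m.prod n)) (hφ : MemLp φ 2 n) :
    MemLp (fun x => ∫ y, f (x, y) * φ y ∂n) 2 m := by
  have hm : AEStronglyMeasurable (fun x => ∫ y, f (x, y) * φ y ∂n) m :=
    (hf.1.mul hφ.1.comp_snd).integral_prod_right'
  rw [memLp_two_iff_integrable_sq hm]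
  refine Integrable.mono' (hf.integrable_sq.integral_prod_left.mul_const (∫ y, φ y ^ 2 ∂n))
    (hm.pow 2) ?_
  filter_upwards [ae_memLp_slice hf] with x hx
  rw [Real.norm_eq_abs, abs_of_nonneg (sq_nonneg _)]
  exact sq_integral_mul_le hx hφ

lemma integral_integral_slice_mul (hf : MemLp f 2 (m.prod n)) (hφ : MemLp φ 2 n)
    (hχ : MemLp χ 2 m) :
    ∫ x, (∫ y, f (x, y) * φ y ∂n) * χ x ∂m = ∫ p, f p * (χ p.1 * φ p.2) ∂m.prod n := by
  rw [integral_prod _ (hf.integrable_mul_two (memLp_mul_prod hχ hφ))]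
  congr 1; ext x
  rw [← integral_mul_const]
  congr 1; ext y
  ring

end Slices

/-! ### Parseval families -/

/-- A family of square integrable functions that satisfies Parseval's identity. -/
structure IsParsevalFamily {X ι : Type*} [MeasurableSpace X] (m : Measure X) (φ : ι → X → ℝ) :
    Prop where
  memLp : ∀ i, MemLp (φ i) 2 m
  lintegral_sq : ∀ f : X → ℝ, MemLp f 2 m →
    ∫⁻ x, ENNReal.ofReal (f x ^ 2) ∂m = ∑' i, ENNReal.ofReal ((∫ x, f x * φ i x ∂m) ^ 2)

namespace IsParsevalFamily

variable {X Y ι κ : Type*} [MeasurableSpace X] [MeasurableSpace Y] {m : Measure X} {n : Measure Y}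
  {φ : ι → X → ℝ} {χ : κ → Y → ℝ}

/-- Parseval in `y` on almost every slice, then Parseval in `x` for each coefficient function. The
index of the second factor comes first, to match `Fin.insertNthEquiv`. -/
lemma prod [SFinite m] [SFinite n] [Countable κ] (hφ : IsParsevalFamily m φ)
    (hχ : IsParsevalFamily n χ) :
    IsParsevalFamily (m.prod n) fun (p : κ × ι) (x : X × Y) => φ p.2 x.1 * χ p.1 x.2 := by
  refine ⟨fun p => memLp_mul_prod (hφ.memLp _) (hχ.memLp _), fun f hf => ?_⟩
  rw [lintegral_prod _ (hf.1.aemeasurable.pow_const 2).ennreal_ofReal]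
  trans ∫⁻ x, ∑' j, ENNReal.ofReal ((∫ y, f (x, y) * χ j y ∂n) ^ 2) ∂m
  · refine lintegral_congr_ae ?_
    filter_upwards [ae_memLp_slice hf] with x hx using hχ.lintegral_sq _ hx
  rw [lintegral_tsum fun j =>
    ((memLp_integral_slice hf (hχ.memLp j)).1.aemeasurable.pow_const 2).ennreal_ofReal,
    ENNReal.tsum_prod']
  refine tsum_congr fun j => ?_
  rw [hφ.lintegral_sq _ (memLp_integral_slice hf (hχ.memLp j))]
  refine tsum_congr fun i => ?_
  rw [integral_integral_slice_mul hf (hχ.memLp j) (hφ.memLp i)]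

/-- Transport along a measure preserving equivalence and a bijection of the index sets. -/
lemma transport (hφ : IsParsevalFamily m φ) (T : X ≃ᵐ Y) (hT : MeasurePreserving T m n)
    (σ : ι ≃ κ) (h : ∀ i x, χ (σ i) (T x) = φ i x) : IsParsevalFamily n χ := by
  have key : ∀ i, χ (σ i) ∘ T = φ i := fun i => funext (h i)
  refine ⟨fun k => ?_, fun f hf => ?_⟩
  · obtain ⟨i, rfl⟩ := σ.surjective k
    rw [← hT.map_eq, T.memLp_map_measure_iff, key]
    exact hφ.memLp i
  · have h1 := hφ.lintegral_sq (f ∘ T) (by rwa [← T.memLp_map_measure_iff, hT.map_eq])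
    rw [← hT.map_eq, lintegral_map_equiv, ← σ.tsum_eq]
    refine h1.trans (tsum_congr fun i => ?_)
    rw [hT.map_eq, ← hT.integral_comp']
    simp only [h, Function.comp_apply]

/-- All coefficients of `f - g` vanish, hence so does its norm. -/
lemma ae_eq (hφ : IsParsevalFamily m φ) {f g : X → ℝ} (hf : MemLp f 2 m) (hg : MemLp g 2 m)
    (h : ∀ i, ∫ x, f x * φ i x ∂m = ∫ x, g x * φ i x ∂m) : f =ᵐ[m] g := by
  have h1 := hφ.lintegral_sq _ (hf.sub hg)
  have h2 : ∀ i, ∫ x, (f - g) x * φ i x ∂m = 0 := fun i => by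
    simp only [Pi.sub_apply, sub_mul]
    rw [integral_sub (hf.integrable_mul_two (hφ.memLp i)) (hg.integrable_mul_two (hφ.memLp i)), h,
      sub_self]
  simp only [h2, ne_eq, OfNat.ofNat_ne_zero, not_false_eq_true, zero_pow, ENNReal.ofReal_zero,
    tsum_zero] at h1
  rw [lintegral_eq_zero_iff' ((hf.sub hg).1.aemeasurable.pow_const 2).ennreal_ofReal] at h1
  filter_upwards [h1] with x hx
  simp only [Pi.sub_apply, Pi.zero_apply, ENNReal.ofReal_eq_zero] at hx
  have := pow_eq_zero_iff (two_ne_zero) |>.1 (le_antisymm hx (sq_nonneg _))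
  linarith

end IsParsevalFamily

lemma IsPoincareBasis.isParsevalFamily {a b : EReal} {μ : Measure ℝ} {w : ℝ → ℝ}
    {φ : ℕ → ℝ → ℝ} {lam : ℕ → ℝ} (h : IsPoincareBasis a b μ w φ lam) :
    IsParsevalFamily μ φ := by
  refine ⟨h.memLp, fun f hf => ?_⟩
  have hs := h.hasSum_sq hf
  rw [← ENNReal.ofReal_tsum_of_nonneg (fun _ => sq_nonneg _) hs.summable, hs.tsum_eq,
    ofReal_integral_eq_lintegral_ofReal hf.integrable_sq (ae_of_all _ fun _ => sq_nonneg _)]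

/-! ### Splitting off one coordinate -/

section Split

variable {n : ℕ}

/-- The map `(y, t) ↦ Fin.insertNth i t y` as a measurable equivalence. -/
def insertNthMeasurableEquiv (i : Fin (n + 1)) : (Fin n → ℝ) × ℝ ≃ᵐ (Fin (n + 1) → ℝ) :=
  MeasurableEquiv.prodComm.trans (MeasurableEquiv.piFinSuccAbove (fun _ => ℝ) i).symm

lemma insertNthMeasurableEquiv_apply (i : Fin (n + 1)) (p : (Fin n → ℝ) × ℝ) :
    insertNthMeasurableEquiv i p = i.insertNth p.2 p.1 := rfl

lemma measurePreserving_insertNth (μ : Fin (n + 1) → Measure ℝ) [∀ k, IsProbabilityMeasure (μ k)]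
    (i : Fin (n + 1)) :
    MeasurePreserving (insertNthMeasurableEquiv i)
      ((Measure.pi fun k => μ (i.succAbove k)).prod (μ i)) (Measure.pi μ) :=
  (measurePreserving_piFinSuccAbove μ i).symm.comp Measure.measurePreserving_swap

lemma tensorBasis_insertNth (ψ : Fin (n + 1) → ℕ → ℝ → ℝ) (i : Fin (n + 1)) (j : ℕ)
    (β : Fin n → ℕ) (t : ℝ) (y : Fin n → ℝ) :
    tensorBasis ψ (i.insertNth j β) (i.insertNth t y) =
      tensorBasis (fun k => ψ (i.succAbove k)) β y * ψ i j t := by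
  simp [tensorBasis, Fin.prod_univ_succAbove _ i, mul_comm]

end Split

/-- The tensor products of Parseval families form a Parseval family. -/
theorem isParsevalFamily_tensorBasis : ∀ {d : ℕ} (μ : Fin d → Measure ℝ)
    [∀ k, IsProbabilityMeasure (μ k)] (ψ : Fin d → ℕ → ℝ → ℝ),
    (∀ k, IsParsevalFamily (μ k) (ψ k)) → IsParsevalFamily (Measure.pi μ) (tensorBasis ψ)
  | 0, μ, _, ψ, _ => by
    have e : Measure.pi μ = Measure.dirac default := by
      rw [Measure.pi_of_empty μ default]
    rw [e]
    refine ⟨fun α => ?_, fun f _ => ?_⟩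
    · have : tensorBasis ψ α = fun _ => 1 := by ext; simp [tensorBasis]
      rw [this]
      exact memLp_const _
    · rw [lintegral_dirac, tsum_eq_single default fun α h => absurd (Subsingleton.elim _ _) h,
        integral_dirac]
      simp [tensorBasis]
  | n + 1, μ, _, ψ, h => by
    have ih := isParsevalFamily_tensorBasis (fun k => μ ((0 : Fin (n + 1)).succAbove k))
      (fun k => ψ ((0 : Fin (n + 1)).succAbove k)) fun k => h _
    exact (ih.prod (h 0)).transport _ (measurePreserving_insertNth μ 0)
      (Fin.insertNthEquiv (fun _ => ℕ) 0) fun p x => tensorBasis_insertNth ψ 0 _ _ _ _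

/-! ### The sensitivity measure -/

/-- Measurability of a partial derivative. -/
lemma aemeasurable_deriv_snd {X : Type*} [MeasurableSpace X] {m : Measure X} [SFinite m]
    {μ : Measure ℝ} [SFinite μ] {I : Set ℝ} (hI : IsOpen I) (h1 : μ ≪ volume.restrict I)
    (h2 : volume.restrict I ≪ μ) {f : X × ℝ → ℝ} (hf : AEMeasurable f (m.prod μ))
    (hd : ∀ᵐ x ∂m, ∀ t ∈ I, DifferentiableAt ℝ (fun s => f (x, s)) t) :
    AEMeasurable (fun p => deriv (fun s => f (p.1, s)) p.2) (m.prod μ) := by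
  have hs : MeasurableSet (univ ×ˢ I : Set (X × ℝ)) := MeasurableSet.univ.prod hI.measurableSet
  -- Translations need not preserve `μ`-null sets, but they preserve Lebesgue measure. So `f` is
  -- extended by zero off `I` and the difference quotients are shown measurable with respect to
  -- `m.prod volume` first.
  set G := indicator (univ ×ˢ I : Set (X × ℝ)) f with hG
  have hGm : AEMeasurable G (m.prod volume) := by
    rw [hG, aemeasurable_indicator_iff hs, ← Measure.prod_restrict, Measure.restrict_univ]
    exact hf.mono_ac (Measure.AbsolutelyContinuous.rfl.prod h2)
  have hac : m.prod μ ≪ m.prod volume := Measure.AbsolutelyContinuous.rfl.prod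
    (h1.trans Measure.absolutelyContinuous_restrict)
  have hshift : ∀ c : ℝ, AEMeasurable (fun p : X × ℝ => G (p.1, p.2 + c)) (m.prod μ) := fun c =>
    (hGm.comp_quasiMeasurePreserving ((MeasurePreserving.id m).prod
      (measurePreserving_add_right volume c)).quasiMeasurePreserving).mono_ac hac
  refine aemeasurable_of_tendsto_metrizable_ae atTop
    (f := fun (k : ℕ) (p : X × ℝ) =>
      ((k : ℝ) + 1) * (G (p.1, p.2 + 1 / ((k : ℝ) + 1)) - G (p.1, p.2 + 0)))
    (fun k => ((hshift _).sub (hshift 0)).const_mul _) ?_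
  have hmem : ∀ᵐ p ∂m.prod μ, p.2 ∈ I := Measure.quasiMeasurePreserving_snd.ae
    (h1 (ae_restrict_mem hI.measurableSet))
  filter_upwards [hmem, Measure.quasiMeasurePreserving_fst.ae hd] with p hp hdp
  have h3 := (hdp _ hp).hasDerivAt.tendsto_slope_zero_right
  have hk : Tendsto (fun k : ℕ => 1 / ((k : ℝ) + 1)) atTop (𝓝[>] 0) := by
    rw [tendsto_nhdsWithin_iff]
    exact ⟨tendsto_one_div_add_atTop_nhds_zero_nat, Eventually.of_forall fun k =>
      mem_Ioi.2 Nat.one_div_pos_of_nat⟩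
  have hin : ∀ᶠ k : ℕ in atTop, p.2 + 1 / ((k : ℝ) + 1) ∈ I := by
    have : Tendsto (fun k : ℕ => p.2 + 1 / ((k : ℝ) + 1)) atTop (𝓝 (p.2 + 0)) :=
      tendsto_const_nhds.add tendsto_one_div_add_atTop_nhds_zero_nat
    rw [add_zero] at this
    exact this.eventually (hI.mem_nhds hp)
  refine (h3.comp hk).congr' ?_
  filter_upwards [hin] with k hk
  have e1 : G (p.1, p.2 + 1 / ((k : ℝ) + 1)) = f (p.1, p.2 + 1 / ((k : ℝ) + 1)) :=
    indicator_of_mem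
    (show (p.1, p.2 + 1 / ((k : ℝ) + 1)) ∈ univ ×ˢ I from ⟨mem_univ _, hk⟩) _
  have e2 : G (p.1, p.2 + 0) = f (p.1, p.2) := by
    rw [add_zero]
    exact indicator_of_mem (show (p.1, p.2) ∈ univ ×ˢ I from ⟨mem_univ _, hp⟩) _
  simp only [Function.comp_apply, smul_eq_mul, one_div, inv_inv] at e1 ⊢
  rw [e1, e2]

lemma ae_pi_mem_openInterval {d : ℕ} {a b : Fin d → EReal} {μ : Fin d → Measure ℝ}
    (hμ : ∀ k, μ k ∈ densityClass (a k) (b k)) :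
    ∀ᵐ x ∂Measure.pi μ, ∀ k, x k ∈ openInterval (a k) (b k) := by
  have : ∀ k, IsProbabilityMeasure (μ k) := fun k => (hμ k).1
  rw [ae_all_iff]
  exact fun k => (measurePreserving_eval μ k).quasiMeasurePreserving.ae (ae_mem_openInterval (hμ k))

lemma partialDeriv_insertNth {n : ℕ} (i : Fin (n + 1)) (M : (Fin (n + 1) → ℝ) → ℝ) (t : ℝ)
    (y : Fin n → ℝ) :
    partialDeriv i M (i.insertNth t y) = deriv (fun s => M (i.insertNth s y)) t := by
  simp [partialDeriv]

lemma chaosCoeff_insertNth {n : ℕ} (μ : Fin (n + 1) → Measure ℝ)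
    [∀ k, IsProbabilityMeasure (μ k)] (ψ : Fin (n + 1) → ℕ → ℝ → ℝ)
    (M : (Fin (n + 1) → ℝ) → ℝ) (i : Fin (n + 1)) (j : ℕ) (β : Fin n → ℕ) :
    chaosCoeff μ ψ M (i.insertNth j β) =
      ∫ p, M (i.insertNth p.2 p.1) * (tensorBasis (fun k => ψ (i.succAbove k)) β p.1 * ψ i j p.2)
        ∂(Measure.pi fun k => μ (i.succAbove k)).prod (μ i) := by
  rw [chaosCoeff, ← (measurePreserving_insertNth μ i).integral_comp']
  simp only [insertNthMeasurableEquiv_apply, tensorBasis_insertNth]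

lemma memLp_comp_insertNth {n : ℕ} {μ : Fin (n + 1) → Measure ℝ}
    [∀ k, IsProbabilityMeasure (μ k)] {M : (Fin (n + 1) → ℝ) → ℝ} (hM : MemLp M 2 (Measure.pi μ))
    (i : Fin (n + 1)) :
    MemLp (fun p : (Fin n → ℝ) × ℝ => M (i.insertNth p.2 p.1)) 2
      ((Measure.pi fun k => μ (i.succAbove k)).prod (μ i)) :=
  hM.comp_measurePreserving (measurePreserving_insertNth μ i)

lemma lintegral_pi_insertNth {n : ℕ} (μ : Fin (n + 1) → Measure ℝ)
    [∀ k, IsProbabilityMeasure (μ k)] (i : Fin (n + 1)) (F : (Fin (n + 1) → ℝ) → ℝ≥0∞) :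
    ∫⁻ x, F x ∂Measure.pi μ =
      ∫⁻ p, F (i.insertNth p.2 p.1) ∂(Measure.pi fun k => μ (i.succAbove k)).prod (μ i) := by
  rw [← (measurePreserving_insertNth μ i).map_eq, lintegral_map_equiv]
  rfl

/-- The sensitivity measure, in terms of the coefficients of the Poincaré chaos expansion. -/
theorem dgsm_eq_tsum {d : ℕ} {a b : Fin d → EReal} {μ : Fin d → Measure ℝ}
    (hμ : ∀ k, μ k ∈ densityClass (a k) (b k)) {w : Fin d → ℝ → ℝ}
    (hw : ∀ k, w k ∈ weightClass (a k) (b k)) {ψ : Fin d → ℕ → ℝ → ℝ} {lam : Fin d → ℕ → ℝ}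
    (hψ : ∀ k, IsPoincareBasis (a k) (b k) (μ k) (w k) (ψ k) (lam k))
    {M : (Fin d → ℝ) → ℝ} (hM : MemLp M 2 (Measure.pi μ)) (i : Fin d)
    (hdiff : ∀ x : Fin d → ℝ, (∀ k, x k ∈ openInterval (a k) (b k)) →
      DifferentiableAt ℝ (fun t => M (Function.update x i t)) (x i)) :
    dgsm μ (w i) i M = ∑' α, ENNReal.ofReal (lam i (α i) * chaosCoeff μ ψ M α ^ 2) := by
  obtain _ | n := d
  · exact i.elim0
  have : ∀ k, IsProbabilityMeasure (μ k) := fun k => (hμ k).1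
  have hM' := memLp_comp_insertNth hM i
  have hd : ∀ᵐ y ∂Measure.pi fun k => μ (i.succAbove k), ∀ t ∈ openInterval (a i) (b i),
      DifferentiableAt ℝ (fun s => M (i.insertNth s y)) t := by
    filter_upwards [ae_pi_mem_openInterval fun k => hμ (i.succAbove k)] with y hy t ht
    have := hdiff (i.insertNth t y) (by
      rw [Fin.forall_iff_succAbove i]
      simpa using ⟨ht, hy⟩)
    simpa using this
  -- Joint measurability is needed for Tonelli; it does not follow from differentiability along
  -- lines alone, so it comes from the difference quotients.
  have hmeas : AEMeasurable (fun p : (Fin n → ℝ) × ℝ => ENNReal.ofReal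
      (w i p.2 * deriv (fun s => M (i.insertNth s p.1)) p.2 ^ 2))
      ((Measure.pi fun k => μ (i.succAbove k)).prod (μ i)) :=
    (((aemeasurable_weight (hμ i) (hw i)).comp_quasiMeasurePreserving
      Measure.quasiMeasurePreserving_snd).mul
      ((aemeasurable_deriv_snd (isOpen_openInterval _ _)
        (absolutelyContinuous_of_mem_densityClass (hμ i))
        (restrict_absolutelyContinuous_of_mem_densityClass (hμ i)) hM'.1.aemeasurable
        hd).pow_const 2)).ennreal_ofReal
  rw [dgsm, lintegral_pi_insertNth μ i]
  simp only [partialDeriv_insertNth, Fin.insertNth_apply_same]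
  rw [lintegral_prod _ hmeas]
  trans ∫⁻ y, ∑' j, ENNReal.ofReal (lam i j * (∫ t, M (i.insertNth t y) * ψ i j t ∂μ i) ^ 2)
      ∂Measure.pi fun k => μ (i.succAbove k)
  · refine lintegral_congr_ae ?_
    filter_upwards [hd, ae_memLp_slice hM'] with y h1 h2
    exact (hψ i).lintegral_weight_mul_deriv_sq (hμ i) (hw i) h1 h2
  have hpars := isParsevalFamily_tensorBasis (fun k => μ (i.succAbove k))
    (fun k => ψ (i.succAbove k)) fun k => (hψ _).isParsevalFamily
  -- The multi-index splits as `α = i.insertNth j β`; for fixed `j`, Parseval in the other variables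
  -- produces the sum over `β`.
  rw [lintegral_tsum fun j => (((memLp_integral_slice hM'
      ((hψ i).memLp j)).1.aemeasurable.pow_const 2).const_mul _).ennreal_ofReal,
    ← (Fin.insertNthEquiv (fun _ => ℕ) i).tsum_eq, ENNReal.tsum_prod']
  refine tsum_congr fun j => ?_
  simp only [ENNReal.ofReal_mul ((hψ i).lam_nonneg _)]
  rw [lintegral_const_mul' _ _ ENNReal.ofReal_ne_top, hpars.lintegral_sq _
    (memLp_integral_slice hM' ((hψ i).memLp j)), ← ENNReal.tsum_mul_left]
  refine tsum_congr fun β => ?_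
  rw [integral_integral_slice_mul hM' ((hψ i).memLp j) (hpars.memLp β)]
  have e : Fin.insertNthEquiv (fun _ => ℕ) i (j, β) = i.insertNth j β := rfl
  rw [e, chaosCoeff_insertNth, Fin.insertNth_apply_same]

lemma tsum_subtype_one_le_eq {d : ℕ} (i : Fin d) (F : (Fin d → ℕ) → ℝ≥0∞)
    (hF : ∀ α, α i = 0 → F α = 0) : ∑' α : {α : Fin d → ℕ // 1 ≤ α i}, F α.1 = ∑' α, F α :=
  tsum_subtype_eq_of_support_subset (s := {α : Fin d → ℕ | 1 ≤ α i}) fun α hα =>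
    Nat.one_le_iff_ne_zero.2 fun h0 => hα (hF α h0)

/-! ### The Sobol'-Hoeffding decomposition -/

/-- The set of coordinates on which a multi-index does not vanish. -/
def multiSupport {d : ℕ} (α : Fin d → ℕ) : Finset (Fin d) := {k | α k ≠ 0}

lemma mem_multiSupport {d : ℕ} {α : Fin d → ℕ} {k : Fin d} : k ∈ multiSupport α ↔ α k ≠ 0 := by
  simp [multiSupport]

/-- The `σ`-algebra generated by the coordinates in `J`. -/
abbrev coordSigma {d : ℕ} (J : Finset (Fin d)) : MeasurableSpace (Fin d → ℝ) :=
  MeasurableSpace.comap (fun x : Fin d → ℝ => J.restrict x) inferInstance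

lemma coordSigma_le {d : ℕ} (J : Finset (Fin d)) : coordSigma J ≤ MeasurableSpace.pi :=
  (Finset.measurable_restrict J).comap_le

section

variable {d : ℕ} {a b : Fin d → EReal} {μ : Fin d → Measure ℝ} {w : Fin d → ℝ → ℝ}
  {ψ : Fin d → ℕ → ℝ → ℝ} {lam : Fin d → ℕ → ℝ}

/-- A function that does not depend on the coordinate `k` is orthogonal to the basis functions
that do. -/
lemma chaosCoeff_eq_zero (hμ : ∀ k, μ k ∈ densityClass (a k) (b k))
    (hw : ∀ k, w k ∈ weightClass (a k) (b k))
    (hψ : ∀ k, IsPoincareBasis (a k) (b k) (μ k) (w k) (ψ k) (lam k))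
    {f : (Fin d → ℝ) → ℝ} (hf : MemLp f 2 (Measure.pi μ)) {J : Finset (Fin d)}
    {G : (J → ℝ) → ℝ} (hG : f = fun x => G (J.restrict x)) {α : Fin d → ℕ}
    (hα : ¬ multiSupport α ⊆ J) : chaosCoeff μ ψ f α = 0 := by
  obtain ⟨k, hk, hkJ⟩ := Finset.not_subset.1 hα
  rw [mem_multiSupport] at hk
  obtain _ | n := d
  · exact k.elim0
  have : ∀ k, IsProbabilityMeasure (μ k) := fun k => (hμ k).1
  have hpars := isParsevalFamily_tensorBasis (fun l => μ (k.succAbove l))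
    (fun l => ψ (k.succAbove l)) fun l => (hψ _).isParsevalFamily
  have hconst : ∀ t y, f (k.insertNth t y) = f (k.insertNth 0 y) := fun t y => by
    rw [hG]
    refine congrArg G (funext fun l => ?_)
    have hl : l.1 ≠ k := fun h => hkJ (h ▸ l.2)
    obtain ⟨m, hm⟩ := Fin.exists_succAbove_eq hl
    simp [Finset.restrict, ← hm]
  rw [← Fin.insertNth_self_removeNth k α, chaosCoeff_insertNth,
    ← integral_integral_slice_mul (memLp_comp_insertNth hf k) ((hψ k).memLp _) (hpars.memLp _)]
  simp only [hconst, integral_const_mul, (hψ k).integral_eq_zero (hμ k) (hw k) hk, mul_zero,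
    zero_mul, integral_zero]

/-- A factor with `k ∉ J` has index `0` and is constant, but only almost everywhere, whence
measurability up to a null set. -/
lemma aestronglyMeasurable_tensorBasis (hμ : ∀ k, μ k ∈ densityClass (a k) (b k))
    (hw : ∀ k, w k ∈ weightClass (a k) (b k))
    (hψ : ∀ k, IsPoincareBasis (a k) (b k) (μ k) (w k) (ψ k) (lam k))
    {J : Finset (Fin d)} {α : Fin d → ℕ} (hα : multiSupport α ⊆ J) :
    AEStronglyMeasurable[coordSigma J] (tensorBasis ψ α) (Measure.pi μ) := by
  have : ∀ k, IsProbabilityMeasure (μ k) := fun k => (hμ k).1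
  suffices H : ∀ k, AEStronglyMeasurable[coordSigma J] (fun x => ψ k (α k) (x k))
      (Measure.pi μ) by
    choose g hg hae using H
    refine ⟨fun x => ∏ k, g k x, Finset.stronglyMeasurable_fun_prod _ fun k _ => hg k, ?_⟩
    filter_upwards [ae_all_iff.2 hae] with x hx
    exact Finset.prod_congr rfl fun k _ => hx k
  intro k
  have hq := (measurePreserving_eval μ k).quasiMeasurePreserving
  by_cases hk : k ∈ J
  · refine ⟨fun x => ((hψ k).memLp (α k)).1.mk _ (x k), ?_,
      hq.ae_eq_comp ((hψ k).memLp (α k)).1.ae_eq_mk⟩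
    refine ((hψ k).memLp (α k)).1.stronglyMeasurable_mk.comp_measurable ?_
    exact (measurable_pi_apply (X := fun _ : J => ℝ) (⟨k, hk⟩ : J)).comp (comap_measurable _)
  · have h0 : α k = 0 := by
      by_contra h
      exact hk (hα (mem_multiSupport.2 h))
    obtain ⟨c, -, hc⟩ := (hψ k).exists_ae_eq_const (hμ k) (hw k)
    rw [h0]
    exact ⟨fun _ => c, stronglyMeasurable_const, hq.ae_eq_comp hc⟩

lemma isParsevalFamily_of_isPoincareBasis (hμ : ∀ k, μ k ∈ densityClass (a k) (b k))
    (hψ : ∀ k, IsPoincareBasis (a k) (b k) (μ k) (w k) (ψ k) (lam k)) :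
    IsParsevalFamily (Measure.pi μ) (tensorBasis ψ) := by
  have : ∀ k, IsProbabilityMeasure (μ k) := fun k => (hμ k).1
  exact isParsevalFamily_tensorBasis μ ψ fun k => (hψ k).isParsevalFamily

/-- Doob-Dynkin factorization. -/
lemma exists_condExp_eq {P : Measure (Fin d → ℝ)} (f : (Fin d → ℝ) → ℝ) (J : Finset (Fin d)) :
    ∃ G : (J → ℝ) → ℝ, P[f | coordSigma J] = fun x => G (J.restrict x) := by
  obtain ⟨G, -, hG⟩ :=
    (stronglyMeasurable_condExp (μ := P) (m := coordSigma J) (f := f)).exists_eq_measurable_comp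
  exact ⟨G, hG⟩

open Classical in
/-- The chaos coefficients of a conditional expectation. -/
lemma chaosCoeff_condExp (hμ : ∀ k, μ k ∈ densityClass (a k) (b k))
    (hw : ∀ k, w k ∈ weightClass (a k) (b k))
    (hψ : ∀ k, IsPoincareBasis (a k) (b k) (μ k) (w k) (ψ k) (lam k))
    {f : (Fin d → ℝ) → ℝ} (hf : MemLp f 2 (Measure.pi μ)) (J : Finset (Fin d))
    (α : Fin d → ℕ) :
    chaosCoeff μ ψ ((Measure.pi μ)[f | coordSigma J]) α =
      if multiSupport α ⊆ J then chaosCoeff μ ψ f α else 0 := by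
  have : ∀ k, IsProbabilityMeasure (μ k) := fun k => (hμ k).1
  have hpars := isParsevalFamily_of_isPoincareBasis hμ hψ
  split_ifs with h
  -- Here `tensorBasis ψ α` can be pulled into the conditional expectation, which preserves the
  -- integral.
  · have h1 := condExp_mul_of_aestronglyMeasurable_right
      (aestronglyMeasurable_tensorBasis hμ hw hψ h) (hf.integrable_mul (hpars.memLp α))
      (hf.integrable one_le_two)
    exact (integral_congr_ae h1.symm).trans (integral_condExp (coordSigma_le J))
  · obtain ⟨G, hG⟩ := exists_condExp_eq (P := Measure.pi μ) f J
    exact chaosCoeff_eq_zero hμ hw hψ (hf.condExp one_le_two) hG h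

lemma chaosCoeff_sub (hP : IsParsevalFamily (Measure.pi μ) (tensorBasis ψ))
    {f g : (Fin d → ℝ) → ℝ} (hf : MemLp f 2 (Measure.pi μ)) (hg : MemLp g 2 (Measure.pi μ))
    (α : Fin d → ℕ) :
    chaosCoeff μ ψ (fun x => f x - g x) α = chaosCoeff μ ψ f α - chaosCoeff μ ψ g α := by
  simp only [chaosCoeff, sub_mul]
  exact integral_sub (hf.integrable_mul_two (hP.memLp α)) (hg.integrable_mul_two (hP.memLp α))

lemma chaosCoeff_sum (hP : IsParsevalFamily (Measure.pi μ) (tensorBasis ψ)) {ι : Type*}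
    (s : Finset ι) {f : ι → (Fin d → ℝ) → ℝ} (hf : ∀ j ∈ s, MemLp (f j) 2 (Measure.pi μ))
    (α : Fin d → ℕ) :
    chaosCoeff μ ψ (fun x => ∑ j ∈ s, f j x) α = ∑ j ∈ s, chaosCoeff μ ψ (f j) α := by
  simp only [chaosCoeff, Finset.sum_mul]
  exact integral_finsetSum s fun j hj => (hf j hj).integrable_mul_two (hP.memLp α)

open Classical in
-- Möbius inversion by induction: conditioning on `X_I` keeps the supports contained in `I`, and the
-- functions built for strict subsets are subtracted.
lemma exists_chaosCoeff_eq_ite (hμ : ∀ k, μ k ∈ densityClass (a k) (b k))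
    (hw : ∀ k, w k ∈ weightClass (a k) (b k))
    (hψ : ∀ k, IsPoincareBasis (a k) (b k) (μ k) (w k) (ψ k) (lam k))
    {M : (Fin d → ℝ) → ℝ} (hM : MemLp M 2 (Measure.pi μ)) (I : Finset (Fin d)) :
    ∃ h : (Fin d → ℝ) → ℝ, MemLp h 2 (Measure.pi μ) ∧
      ∀ α, chaosCoeff μ ψ h α = if multiSupport α = I then chaosCoeff μ ψ M α else 0 := by
  have hpars := isParsevalFamily_of_isPoincareBasis hμ hψ
  induction I using Finset.strongInduction with
  | H I ih =>
    choose! h h1 h2 using ih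
    have hmem : ∀ J ∈ I.ssubsets, MemLp (h J) 2 (Measure.pi μ) := fun J hJ =>
      h1 J (Finset.mem_ssubsets.1 hJ)
    have hE : MemLp ((Measure.pi μ)[M | coordSigma I]) 2 (Measure.pi μ) := hM.condExp one_le_two
    have hS := memLp_finsetSum I.ssubsets hmem
    refine ⟨fun x => ((Measure.pi μ)[M | coordSigma I]) x - ∑ J ∈ I.ssubsets, h J x, hE.sub hS,
      fun α => ?_⟩
    rw [chaosCoeff_sub hpars hE hS, chaosCoeff_sum hpars _ hmem, chaosCoeff_condExp hμ hw hψ hM,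
      Finset.sum_congr rfl fun J hJ => h2 J (Finset.mem_ssubsets.1 hJ) α]
    simp only [Finset.sum_ite_eq, Finset.mem_ssubsets]
    by_cases e : multiSupport α = I
    · simp [e]
    · by_cases hs : multiSupport α ⊆ I
      · simp [e, hs, hs.ssubset_of_ne e]
      · rw [if_neg hs, if_neg fun h => hs h.subset, if_neg e, sub_zero]

theorem exists_isSobolHoeffding (hμ : ∀ k, μ k ∈ densityClass (a k) (b k))
    (hw : ∀ k, w k ∈ weightClass (a k) (b k))
    (hψ : ∀ k, IsPoincareBasis (a k) (b k) (μ k) (w k) (ψ k) (lam k))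
    {M : (Fin d → ℝ) → ℝ} (hM : MemLp M 2 (Measure.pi μ)) :
    ∃ N : (I : Finset (Fin d)) → (I → ℝ) → ℝ, IsSobolHoeffding (Measure.pi μ) M N := by
  classical
  have hpars := isParsevalFamily_of_isPoincareBasis hμ hψ
  choose h h1 h2 using exists_chaosCoeff_eq_ite hμ hw hψ hM
  -- Conditioning `h I` on `X_I` leaves its coefficients unchanged and yields a genuine function of
  -- `x_I`.
  choose N hN using fun I => exists_condExp_eq (P := Measure.pi μ) (h I) I
  have hmem : ∀ I : Finset (Fin d), MemLp (fun x => N I (I.restrict x)) 2 (Measure.pi μ) :=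
    fun I => hN I ▸ (h1 I).condExp one_le_two
  have hcoef : ∀ (I : Finset (Fin d)) α, chaosCoeff μ ψ (fun x => N I (I.restrict x)) α =
      if multiSupport α = I then chaosCoeff μ ψ M α else 0 := fun I α => by
    rw [← hN, chaosCoeff_condExp hμ hw hψ (h1 I), h2]
    split_ifs with h3 h4 h4
    · rfl
    · rfl
    · exact absurd h4.subset h3
    · rfl
  refine ⟨N, hmem, ?_, fun I J hJ => ?_⟩
  · refine hpars.ae_eq hM (memLp_finsetSum _ fun I _ => hmem I) fun α => ?_
    refine Eq.trans ?_ (chaosCoeff_sum hpars _ (fun I _ => hmem I) α).symm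
    simp only [hcoef, Finset.sum_ite_eq, Finset.mem_univ, if_true]
    rfl
  · refine hpars.ae_eq ((hmem I).condExp one_le_two) MemLp.zero fun α => ?_
    refine (chaosCoeff_condExp hμ hw hψ (hmem I) J α).trans ?_
    rw [hcoef]
    simp only [Pi.zero_apply, zero_mul, integral_zero]
    split_ifs with h3 h4
    · exact absurd (h4 ▸ h3) hJ.not_subset
    · rfl
    · rfl

open Classical in
-- This is the uniqueness of the decomposition. If `multiSupport α` is a strict subset of `J`,
-- conditioning on it preserves the coefficient yet kills `N J`; if it is not contained in `J`, then
-- `N J` ignores one of its coordinates. Only `J = multiSupport α` contributes to the coefficient of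
-- `M`.
lemma IsSobolHoeffding.chaosCoeff_eq (hμ : ∀ k, μ k ∈ densityClass (a k) (b k))
    (hw : ∀ k, w k ∈ weightClass (a k) (b k))
    (hψ : ∀ k, IsPoincareBasis (a k) (b k) (μ k) (w k) (ψ k) (lam k))
    {M : (Fin d → ℝ) → ℝ} {N : (I : Finset (Fin d)) → (I → ℝ) → ℝ}
    (hN : IsSobolHoeffding (Measure.pi μ) M N) (I : Finset (Fin d)) (α : Fin d → ℕ) :
    chaosCoeff μ ψ (fun x => N I (I.restrict x)) α =
      if multiSupport α = I then chaosCoeff μ ψ M α else 0 := by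
  have hpars := isParsevalFamily_of_isPoincareBasis hμ hψ
  have hz : ∀ J, J ≠ multiSupport α → chaosCoeff μ ψ (fun x => N J (J.restrict x)) α = 0 := by
    intro J hJ
    by_cases hs : multiSupport α ⊆ J
    · have h1 := chaosCoeff_condExp hμ hw hψ (hN.memLp J) (multiSupport α) α
      rw [if_pos subset_rfl] at h1
      rw [← h1, chaosCoeff, integral_congr_ae (g := fun _ => 0)]
      · simp
      · filter_upwards [hN.condExp_eq_zero J _ (hs.ssubset_of_ne hJ.symm)] with x hx
        rw [hx, Pi.zero_apply, zero_mul]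
    · exact chaosCoeff_eq_zero hμ hw hψ (hN.memLp J) rfl hs
  split_ifs with h
  · have h1 : chaosCoeff μ ψ M α = chaosCoeff μ ψ (fun x => ∑ I, N I (I.restrict x)) α := by
      refine integral_congr_ae ?_
      filter_upwards [hN.sum_eq] with x hx
      rw [hx]
    rw [h1, chaosCoeff_sum hpars _ fun J _ => hN.memLp J,
      Finset.sum_eq_single_of_mem I (Finset.mem_univ _) fun J _ hJ => hz J (h ▸ hJ)]
  · exact hz I (Ne.symm h)

/-- The Poincaré-type bound for the partial variances. -/
theorem IsSobolHoeffding.ofReal_sum_variance_le (hμ : ∀ k, μ k ∈ densityClass (a k) (b k))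
    (hw : ∀ k, w k ∈ weightClass (a k) (b k))
    (hψ : ∀ k, IsPoincareBasis (a k) (b k) (μ k) (w k) (ψ k) (lam k))
    {M : (Fin d → ℝ) → ℝ} {N : (I : Finset (Fin d)) → (I → ℝ) → ℝ}
    (hN : IsSobolHoeffding (Measure.pi μ) M N) (i : Fin d) :
    ENNReal.ofReal (∑ I with i ∈ I, variance (fun x => N I (I.restrict x)) (Measure.pi μ)) ≤
      ENNReal.ofReal (1 / lam i 1) *
        ∑' α, ENNReal.ofReal (lam i (α i) * chaosCoeff μ ψ M α ^ 2) := by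
  classical
  have : ∀ k, IsProbabilityMeasure (μ k) := fun k => (hμ k).1
  have hpars := isParsevalFamily_of_isPoincareBasis hμ hψ
  have hpos : 0 < lam i 1 := (hψ i).lam_zero ▸ (hψ i).lam_strictMono Nat.one_pos
  have hvar : ∀ I, ENNReal.ofReal (variance (fun x => N I (I.restrict x)) (Measure.pi μ)) ≤
      ∑' α, if multiSupport α = I then ENNReal.ofReal (chaosCoeff μ ψ M α ^ 2) else 0 := by
    intro I
    refine (ENNReal.ofReal_le_ofReal (variance_le_expectation_sq (hN.memLp I).1)).trans_eq ?_
    refine (ofReal_integral_eq_lintegral_ofReal (hN.memLp I).integrable_sq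
      (ae_of_all _ fun _ => sq_nonneg _)).trans ((hpars.lintegral_sq _ (hN.memLp I)).trans
        (tsum_congr fun α => ?_))
    have := hN.chaosCoeff_eq hμ hw hψ I α
    rw [chaosCoeff] at this
    rw [this]
    split_ifs <;> simp
  rw [ENNReal.ofReal_sum_of_nonneg fun I _ => variance_nonneg _ _]
  refine (Finset.sum_le_sum fun I _ => hvar I).trans ?_
  rw [← Summable.tsum_finsetSum fun _ _ => ENNReal.summable, ← ENNReal.tsum_mul_left]
  refine ENNReal.tsum_le_tsum fun α => ?_
  -- Each `α` is counted for one set `I` only, its support, and only when that support contains `i`.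
  rw [Finset.sum_ite_eq]
  split_ifs with h
  · have h1 : 1 ≤ α i := Nat.one_le_iff_ne_zero.2 (mem_multiSupport.1 (Finset.mem_filter.1 h).2)
    rw [← ENNReal.ofReal_mul (by positivity), one_div]
    refine ENNReal.ofReal_le_ofReal ?_
    rw [le_inv_mul_iff₀ hpos]
    exact mul_le_mul_of_nonneg_right ((hψ i).lam_strictMono.monotone h1) (sq_nonneg _)
  · exact zero_le

end

end

theorem mainTheorem3 {d : ℕ} (a b : Fin d → EReal)
    (μ : Fin d → Measure ℝ) (hμ : ∀ k, μ k ∈ densityClass (a k) (b k))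
    (w : Fin d → ℝ → ℝ) (hw : ∀ k, w k ∈ weightClass (a k) (b k))
    (ψ : Fin d → ℕ → ℝ → ℝ) (lam : Fin d → ℕ → ℝ)
    (hψ : ∀ k, IsPoincareBasis (a k) (b k) (μ k) (w k) (ψ k) (lam k))
    (M : (Fin d → ℝ) → ℝ) (hM : MemLp M 2 (Measure.pi μ)) (i : Fin d)
    (hdiff : ∀ x : Fin d → ℝ, (∀ k, x k ∈ openInterval (a k) (b k)) →
      DifferentiableAt ℝ (fun t => M (Function.update x i t)) (x i)) :
    dgsm μ (w i) i M =
        ∑' α : {α : Fin d → ℕ // 1 ≤ α i},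
          ENNReal.ofReal (lam i (α.1 i) * chaosCoeff μ ψ M α.1 ^ 2) ∧
      IsPoincareConstant (a i) (b i) (μ i) (w i) (1 / lam i 1) ∧
      (∃ N : (I : Finset (Fin d)) → (I → ℝ) → ℝ, IsSobolHoeffding (Measure.pi μ) M N) ∧
      (0 < variance M (Measure.pi μ) →
        ∀ N : (I : Finset (Fin d)) → (I → ℝ) → ℝ, IsSobolHoeffding (Measure.pi μ) M N →
          ENNReal.ofReal (totalSobolIndex (Measure.pi μ) M N i) ≤
            ENNReal.ofReal (1 / lam i 1) * dgsm μ (w i) i M /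
              ENNReal.ofReal (variance M (Measure.pi μ))) := by
  have hν := dgsm_eq_tsum hμ hw hψ hM i hdiff
  refine ⟨?_, (hψ i).isPoincareConstant (hμ i) (hw i), exists_isSobolHoeffding hμ hw hψ hM,
    fun hV N hN => ?_⟩
  · rw [hν, tsum_subtype_one_le_eq i fun α =>
      ENNReal.ofReal (lam i (α i) * chaosCoeff μ ψ M α ^ 2)]
    intro α hα
    simp [hα, (hψ i).lam_zero]
  · rw [totalSobolIndex, ENNReal.ofReal_div_of_pos hV, hν]
    exact ENNReal.div_le_div_right (hN.ofReal_sum_variance_le hμ hw hψ i) _
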